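/- **Setting.** Let $(\mathcal X,\Delta)$ be a metric space equipped with a $\sigma$-algebra, let $\mu$ be a probability measure on $\mathcal X$, and let $f^*:\mathcal X\to[K]=\{1,\dots,K\}$ be a measurable ground-truth function. Let $\nu_d$ be the standard Gaussian measure $\mathcal N(0,I_d)$ on $\mathbb R^d$ with the Euclidean norm $\|\cdot\|_2$. Suppose $\mu$ is generated by a conditional generative model $\{(g_i,p_i)\}_{i\in[K]}$, that is, $g_i:\mathbb R^d\to\mathcal X$ is measurable, $p_i\in[0,1]$, and $\mu=\sum_{i=1}^K p_i\,\mu_i$, where $\mu_i=(g_i)_*\nu_d$ is the pushforward of $\nu_d$ under $g_i$. Write $\mathcal B(x,s)$ for the closed ball of radius $s$ around $x$. For a measurable classifier $f:\mathcal X\to[K]$, a probability measure $\rho$ on $\mathcal X$ and $\epsilon>0$ put $$\mathrm{Risk}_\rho(f)=\Pr_{x\sim\rho}\big[f(x)\ne f^*(x)\big],\qquad \mathrm{AdvRisk}^\epsilon_\mu(f)=\Pr_{x\sim\mu}\big[\exists\,x'\in\mathcal B(x,\epsilon):\ f(x')\neq f^*(x')\big],$$ $$\text{In-AdvRisk}^\epsilon_\mu(f)=\Pr_{(x,i)}\big[\exists\,z'\in\mathbb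 R^d:\ g_i(z')\in\mathcal B(x,\epsilon)\ \text{and}\ f(g_i(z'))\ne f^*(g_i(z'))\big],$$ where in the last probability $i$ is drawn with probability $p_i$ and, given $i$, $x\sim\mu_i$. (If an event is not measurable, its probability is understood as outer measure.) Let $\Phi$ be the cumulative distribution function of $\mathcal N(0,1)$, extended by $\Phi(-\infty)=0$ and $\Phi(+\infty)=1$, and let $\Phi^{-1}:[0,1]\to[-\infty,+\infty]$ be its inverse. **Theorem.** Let $\epsilon>0$, and suppose there are $r>0$, $\delta\in(0,1]$ and real numbers $L_i(r)$, $i\in[K]$, such that for every $i\in[K]$ one has $r\cdot L_i(r)\ge\epsilon$, and $g_i$ is $L_i(r)$-locally Lipschitz with probability at least $1-\delta$, that is, $$\Pr_{z\sim\nu_d}\big[\forall z'\in\mathcal B(z,r):\ \Delta(g_i(z'),g_i(z))\le L_i(r)\,\|z'-z\|_2\big]\ge 1-\delta .$$ Then for every measurable classifier $f:\mathcal X\to[K]$, $$\mathrm{AdvRisk}^\epsilon_\mu(f)\ \ge\ \text{In-AdvRisk}^\epsilon_\mu(f)\ \ge\ \sum_{i=1}^K p_i\,\Phi\Big(\Phi^{-1}\big(\mathrm{Risk}_{\mu_i}(f)\big)+\frac{\epsilon}{L_i(r)}\Big)-\delta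 .$$ -/

import Mathlib

open MeasureTheory ProbabilityTheory

noncomputable section

/-- Cumulative distribution function `Φ` of `N(0,1)`, on the extended real line, so that
`Φ(-∞) = 0` and `Φ(+∞) = 1`. -/
def Phi (x : EReal) : ℝ :=
  (gaussianReal 0 1).real {u : ℝ | (u : EReal) ≤ x}

/-- The inverse `Φ⁻¹ : [0,1] → [-∞,+∞]` of `Φ`, written as a quantile function
(see `Phi_PhiInv` and `PhiInv_Phi`). -/
def PhiInv (p : ℝ) : EReal :=
  sInf {x : EReal | p ≤ Phi x}

theorem Phi_coe (x : ℝ) : Phi (x : EReal) = cdf (gaussianReal 0 1) x := by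
  rw [cdf_eq_real, Phi]
  congr 1
  ext u
  simp

theorem Phi_strictMono : StrictMono Phi := by
  intro x y hxy
  obtain ⟨a, hxa, hay⟩ := EReal.lt_iff_exists_real_btwn.1 hxy
  obtain ⟨b, hab, hby⟩ := EReal.lt_iff_exists_real_btwn.1 hay
  have hab' : a < b := EReal.coe_lt_coe_iff.1 hab
  have hdisj : Disjoint {u : ℝ | (u : EReal) ≤ x} (Set.Ioo a b) := by
    rw [Set.disjoint_left]
    intro u hu hu'
    have h1 : (u : EReal) < a := lt_of_le_of_lt hu hxa
    exact absurd (EReal.coe_lt_coe_iff.1 h1) (not_lt.2 hu'.1.le)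
  have hsub : {u : ℝ | (u : EReal) ≤ x} ∪ Set.Ioo a b ⊆ {u : ℝ | (u : EReal) ≤ y} := by
    rintro u (hu | hu)
    · exact le_trans hu hxy.le
    · exact le_trans (EReal.coe_le_coe_iff.2 hu.2.le) hby.le
  have hpos : 0 < (gaussianReal 0 1).real (Set.Ioo a b) := by
    refine ENNReal.toReal_pos (fun h => ?_) (measure_ne_top _ _)
    have h2 := gaussianReal_absolutelyContinuous' 0 (one_ne_zero : (1 : NNReal) ≠ 0) h
    simp [Real.volume_Ioo] at h2
    linarith
  have h3 : (gaussianReal 0 1).real ({u : ℝ | (u : EReal) ≤ x} ∪ Set.Ioo a b)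
      = Phi x + (gaussianReal 0 1).real (Set.Ioo a b) :=
    measureReal_union hdisj measurableSet_Ioo
  have h4 : (gaussianReal 0 1).real ({u : ℝ | (u : EReal) ≤ x} ∪ Set.Ioo a b) ≤ Phi y :=
    measureReal_mono hsub
  linarith

theorem PhiInv_Phi (x : EReal) : PhiInv (Phi x) = x := by
  have h : {y : EReal | Phi x ≤ Phi y} = Set.Ici x := by
    ext y
    exact Phi_strictMono.le_iff_le
  rw [PhiInv, h]
  exact csInf_Ici

theorem exists_Phi_eq {p : ℝ} (hp : p ∈ Set.Icc (0 : ℝ) 1) : ∃ x : EReal, Phi x = p := by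
  rcases hp.1.eq_or_lt with h0 | h0
  · exact ⟨⊥, by simp [Phi, ← h0]⟩
  rcases hp.2.eq_or_lt with h1 | h1
  · exact ⟨⊤, by simp [Phi, h1]⟩
  have hc : Continuous (cdf (gaussianReal 0 1)) := by
    rw [continuous_iff_continuousAt]
    intro x
    have : NullSingletonClass (gaussianReal 0 1) :=
      nullSingletonClass_gaussianReal one_ne_zero
    have hx : (cdf (gaussianReal 0 1)).measure {x} = 0 := by
      rw [measure_cdf]
      exact measure_singleton x
    rw [StieltjesFunction.measure_singleton, ENNReal.ofReal_eq_zero] at hx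
    rw [(monotone_cdf _).continuousAt_iff_leftLim_eq_rightLim, StieltjesFunction.rightLim_eq]
    exact le_antisymm ((monotone_cdf _).leftLim_le le_rfl) (by linarith)
  obtain ⟨x, hx⟩ := mem_range_of_exists_le_of_exists_ge hc
    (((tendsto_cdf_atBot (gaussianReal 0 1)).eventually (gt_mem_nhds h0)).exists.imp
      fun _ h => h.le)
    (((tendsto_cdf_atTop (gaussianReal 0 1)).eventually (lt_mem_nhds h1)).exists.imp
      fun _ h => h.le)
  exact ⟨x, by rw [Phi_coe, hx]⟩

theorem Phi_PhiInv {p : ℝ} (hp : p ∈ Set.Icc (0 : ℝ) 1) : Phi (PhiInv p) = p := by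
  obtain ⟨x, rfl⟩ := exists_Phi_eq hp
  rw [PhiInv_Phi]

/-- The standard Gaussian measure `ν_d` on `ℝ^d` with the Euclidean norm. -/
abbrev nu (d : ℕ) : Measure (EuclideanSpace ℝ (Fin d)) :=
  stdGaussian (EuclideanSpace ℝ (Fin d))

/-- `Risk_μ(f) = Pr_{x ∼ μ}[f x ≠ f* x]`. -/
def Risk {X Y : Type*} [MeasurableSpace X] (μ : Measure X) (fstar f : X → Y) : ℝ :=
  μ.real {x | f x ≠ fstar x}

/-- `AdvRisk_μ^ε(f) = Pr_{x ∼ μ}[∃ x' ∈ B(x,ε), f x' ≠ f* x']`, with closed balls. As always for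
a Mathlib measure, an event that is not measurable gets its outer measure. -/
def AdvRisk {X Y : Type*} [MetricSpace X] [MeasurableSpace X] (μ : Measure X)
    (fstar f : X → Y) (ε : ℝ) : ℝ :=
  μ.real {x | ∃ x' ∈ Metric.closedBall x ε, f x' ≠ fstar x'}

/-- A conditional generative model `{(g_i, p_i)}_{i ∈ [K]}` with latent space `ℝ^d`. -/
structure CondGenModel (d K : ℕ) (X : Type*) [MeasurableSpace X] where
  /-- the generator of each class -/
  g : Fin K → EuclideanSpace ℝ (Fin d) → X
  measurable_g : ∀ i, Measurable (g i)
  /-- the probability of each class -/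
  p : Fin K → ℝ
  p_mem : ∀ i, p i ∈ Set.Icc (0 : ℝ) 1

namespace CondGenModel

/-- The distribution `μ_i = (g_i)_* ν_d` of class `i`. -/
def classMeasure {d K : ℕ} {X : Type*} [MeasurableSpace X]
    (M : CondGenModel d K X) (i : Fin K) : Measure X :=
  (nu d).map (M.g i)

/-- `μ` is generated by the model: `μ = ∑ i, p_i • (g_i)_* ν_d`. -/
def Generates {d K : ℕ} {X : Type*} [MeasurableSpace X]
    (M : CondGenModel d K X) (μ : Measure X) : Prop :=
  μ = ∑ i, ENNReal.ofReal (M.p i) • M.classMeasure i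

/-- The joint law of `(x, i)`: the class `i` has probability `p_i` and, given `i`, the point `x`
is distributed as `(g_i)_* ν_d`. -/
def jointMeasure {d K : ℕ} {X : Type*} [MeasurableSpace X]
    (M : CondGenModel d K X) : Measure (X × Fin K) :=
  ∑ i, ENNReal.ofReal (M.p i) • (M.classMeasure i).map (fun x => (x, i))

/-- `In-AdvRisk^ε(f) =
Pr_{(x,i)}[∃ z', g_i z' ∈ B(x,ε) and f (g_i z') ≠ f* (g_i z')]`, with closed balls. -/
def InAdvRisk {d K : ℕ} {X Y : Type*} [MetricSpace X] [MeasurableSpace X]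
    (M : CondGenModel d K X) (fstar f : X → Y) (ε : ℝ) : ℝ :=
  M.jointMeasure.real
    {q : X × Fin K | ∃ z' : EuclideanSpace ℝ (Fin d),
      M.g q.2 z' ∈ Metric.closedBall q.1 ε ∧ f (M.g q.2 z') ≠ fstar (M.g q.2 z')}

end CondGenModel

/-- `g` is `L`-locally Lipschitz at radius `r` with probability at least `1 - δ`. -/
def LocLipschitzWithProb {d : ℕ} {X : Type*} [MetricSpace X]
    (g : EuclideanSpace ℝ (Fin d) → X) (r L δ : ℝ) : Prop :=
  1 - δ ≤ (nu d).real {z | ∀ z' ∈ Metric.closedBall z r, dist (g z') (g z) ≤ L * ‖z' - z‖}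

end

/-!
The core is the Gaussian isoperimetric inequality, obtained by Bobkov's functional route. Let `I` be
the Gaussian isoperimetric profile `φ ∘ Φ⁻¹`. A two-point inequality for `I` tensorizes to the
discrete cube, and the central limit theorem turns the cube inequality into
`I (∫ f) ≤ ∫ √(I(f)² + ‖∇f‖²)` for the standard Gaussian measure `γ`. Applied to smooth cutoffs of a
compact set `A`, this bounds the growth of `γ` from the `t`-thickening of `A` to the
`(t + τ)`-thickening; as `τ → 0` the quantile of the measure of the `t`-thickening is seen to grow
at rate at least one, that is, `Φ (Φ⁻¹ (γ A) + s) ≤ γ (A_s)`. Inner regularity extends this to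
measurable sets.

The preimage under `g i` of the set of misclassified points has Gaussian measure
`Risk (M.classMeasure i) fstar f`. A latent point at which `g i` is `L`-Lipschitz on the `r`-ball
and which lies within `ε / L ≤ r` of that preimage has an in-distribution adversarial example, so
isoperimetry at distance `ε / L` gives the bound, at the cost of the exceptional probability `δ`.
-/

open Filter Topology
open scoped BigOperators Convolution RealInnerProductSpace

/-! ### The Gaussian density -/

theorem gaussianPDFReal_eq_mul_exp (m : ℝ) (v : NNReal) (x y : ℝ) :
    gaussianPDFReal m v x =
      gaussianPDFReal m v y * Real.exp (((y - m) ^ 2 - (x - m) ^ 2) / (2 * v)) := by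
  simp only [gaussianPDFReal_def]
  rw [mul_assoc (√_)⁻¹, ← Real.exp_add]
  ring_nf

theorem gaussianPDFReal_le_of_abs_le {m : ℝ} {v : NNReal} {x y : ℝ} (h : |x - m| ≤ |y - m|) :
    gaussianPDFReal m v y ≤ gaussianPDFReal m v x := by
  rw [gaussianPDFReal_eq_mul_exp m v x y]
  refine le_mul_of_one_le_right (gaussianPDFReal_nonneg m v y) (Real.one_le_exp ?_)
  have := sub_nonneg.2 (sq_le_sq.2 h)
  positivity

theorem hasDerivAt_gaussianPDFReal (m : ℝ) (v : NNReal) (x : ℝ) :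
    HasDerivAt (gaussianPDFReal m v) (-((x - m) / v) * gaussianPDFReal m v x) x := by
  rw [gaussianPDFReal_def]
  have h : HasDerivAt (fun x : ℝ => -(x - m) ^ 2 / (2 * v)) (-((x - m) / v)) x :=
    ((((hasDerivAt_id x).sub_const m).pow 2).neg.div_const (2 * (v : ℝ))).congr_deriv
      (by simp only [id_eq, Nat.add_one_sub_one, Nat.cast_ofNat, pow_one, mul_one]
          rw [neg_div, mul_div_mul_left _ _ two_ne_zero])
  exact (h.exp.const_mul _).congr_deriv (by ring)

theorem continuous_gaussianPDFReal (m : ℝ) (v : NNReal) : Continuous (gaussianPDFReal m v) :=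
  continuous_iff_continuousAt.2 fun x => (hasDerivAt_gaussianPDFReal m v x).continuousAt

theorem tendsto_gaussianPDFReal_atTop (m : ℝ) {v : NNReal} (hv : v ≠ 0) :
    Tendsto (gaussianPDFReal m v) atTop (𝓝 0) := by
  have h : Tendsto (fun x : ℝ => -((x - m) ^ 2 / (2 * v))) atTop atBot :=
    tendsto_neg_atTop_atBot.comp (((tendsto_pow_atTop two_ne_zero).comp
      (tendsto_atTop_add_const_right _ (-m) tendsto_id)).atTop_div_const (by positivity))
  simpa only [gaussianPDFReal_def, neg_div, Function.comp_def, mul_zero] using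
    (Real.tendsto_exp_atBot.comp h).const_mul (√(2 * Real.pi * v))⁻¹

local notation "φ" => gaussianPDFReal 0 1

theorem stdGaussianPDFReal_pos (x : ℝ) : 0 < φ x := gaussianPDFReal_pos 0 1 x one_ne_zero

theorem stdGaussianPDFReal_neg (x : ℝ) : φ (-x) = φ x := by simp [gaussianPDFReal_def]

theorem stdGaussianPDFReal_le_of_abs_le {x y : ℝ} (h : |x| ≤ |y|) : φ y ≤ φ x :=
  gaussianPDFReal_le_of_abs_le (by simpa using h)

theorem stdGaussianPDFReal_le_one (x : ℝ) : φ x ≤ 1 := by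
  refine (stdGaussianPDFReal_le_of_abs_le (x := 0) (by simp)).trans ?_
  have h : 1 ≤ √(2 * Real.pi) := Real.one_le_sqrt.2 (by linarith [Real.pi_gt_three])
  simpa [gaussianPDFReal_def] using inv_le_one_of_one_le₀ h

theorem hasDerivAt_stdGaussianPDFReal (x : ℝ) : HasDerivAt φ (-x * φ x) x := by
  simpa using hasDerivAt_gaussianPDFReal 0 1 x

/-! ### The distribution function and the quantile function -/

theorem Phi_coe_eq_measureReal (x : ℝ) : Phi x = (gaussianReal 0 1).real (Set.Iic x) := by
  rw [Phi_coe, cdf_eq_real]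

theorem Phi_coe_eq_integral (x : ℝ) : Phi x = ∫ u in Set.Iic x, φ u := by
  rw [Phi_coe_eq_measureReal, Measure.real, gaussianReal_apply_eq_integral 0 one_ne_zero,
    ENNReal.toReal_ofReal (integral_nonneg fun u => gaussianPDFReal_nonneg 0 1 u)]

theorem hasDerivAt_Phi (x : ℝ) : HasDerivAt (fun y : ℝ => Phi y) (φ x) x := by
  have hint : Integrable φ := integrable_gaussianPDFReal 0 1
  have hcont := continuous_gaussianPDFReal 0 1
  have hPhi : (fun y : ℝ => Phi y) = fun y => (∫ u in (0 : ℝ)..y, φ u) + Phi (0 : ℝ) := by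
    ext y
    rw [Phi_coe_eq_integral, Phi_coe_eq_integral, ← sub_eq_iff_eq_add,
      intervalIntegral.integral_Iic_sub_Iic hint.integrableOn hint.integrableOn]
  rw [hPhi]
  exact (intervalIntegral.integral_hasDerivAt_right hint.intervalIntegrable
    (hcont.stronglyMeasurableAtFilter _ _) hcont.continuousAt).add_const _

theorem Phi_top : Phi ⊤ = 1 := by simp [Phi]

theorem Phi_bot : Phi ⊥ = 0 := by simp [Phi]

theorem Phi_mem_Icc (x : EReal) : Phi x ∈ Set.Icc (0 : ℝ) 1 :=
  ⟨measureReal_nonneg, measureReal_le_one⟩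

theorem continuous_Phi : Continuous Phi := by
  have hrange : Set.range Phi = Set.Icc 0 1 :=
    Set.Subset.antisymm (Set.range_subset_iff.2 Phi_mem_Icc) fun _ hp => exists_Phi_eq hp
  exact (Phi_strictMono.isEmbedding_of_ordConnected (hrange ▸ Set.ordConnected_Icc)).continuous

theorem Phi_neg_coe (x : ℝ) : Phi ((-x : ℝ) : EReal) = 1 - Phi x := by
  have : NullSingletonClass (gaussianReal 0 1) := nullSingletonClass_gaussianReal one_ne_zero
  have hsymm : (gaussianReal 0 1).map (fun x => -x) = gaussianReal 0 1 := by
    simpa using gaussianReal_map_neg (μ := 0) (v := 1)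
  calc Phi ((-x : ℝ) : EReal) = (gaussianReal 0 1).real ((fun x => -x) ⁻¹' Set.Iic (-x)) := by
        rw [← map_measureReal_apply measurable_neg measurableSet_Iic, hsymm,
          Phi_coe_eq_measureReal]
    _ = (gaussianReal 0 1).real (Set.Ioi x) := by
        rw [Set.neg_preimage, Set.neg_Iic, neg_neg]
        exact measureReal_congr Ioi_ae_eq_Ici.symm
    _ = 1 - Phi x := by
        rw [← Set.compl_Iic, probReal_compl_eq_one_sub measurableSet_Iic, Phi_coe_eq_measureReal]

theorem exists_eq_Phi_coe {p : ℝ} (hp : p ∈ Set.Ioo (0 : ℝ) 1) : ∃ y : ℝ, p = Phi y := by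
  obtain ⟨x, rfl⟩ := exists_Phi_eq (Set.Ioo_subset_Icc_self hp)
  induction x with
  | bot => simp [Phi_bot] at hp
  | top => simp [Phi_top] at hp
  | coe x => exact ⟨x, rfl⟩

theorem monotone_PhiInv : Monotone PhiInv := fun _ _ h => sInf_le_sInf fun _ hx => h.trans hx

theorem PhiInv_one : PhiInv 1 = ⊤ := by rw [← Phi_top, PhiInv_Phi]

theorem PhiInv_of_one_le {p : ℝ} (hp : 1 ≤ p) : PhiInv p = ⊤ :=
  top_le_iff.1 (PhiInv_one.ge.trans (monotone_PhiInv hp))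

theorem continuous_PhiInv : Continuous PhiInv :=
  monotone_PhiInv.continuous_of_surjective fun x => ⟨Phi x, PhiInv_Phi x⟩

/-- The quantile function `Φ⁻¹` of `N(0,1)` as a real-valued function; it has the junk value `0`
outside `(0, 1)`, where `PhiInv` is infinite. -/
noncomputable def quantile (p : ℝ) : ℝ := (PhiInv p).toReal

theorem quantile_Phi (y : ℝ) : quantile (Phi y) = y := by
  rw [quantile, PhiInv_Phi, EReal.toReal_coe]

theorem Phi_quantile {p : ℝ} (hp : p ∈ Set.Ioo (0 : ℝ) 1) : Phi (quantile p) = p := by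
  obtain ⟨y, rfl⟩ := exists_eq_Phi_coe hp
  rw [quantile_Phi]

theorem strictMonoOn_quantile : StrictMonoOn quantile (Set.Ioo 0 1) := by
  intro p hp p' hp' h
  rwa [← Phi_quantile hp, ← Phi_quantile hp', Phi_strictMono.lt_iff_lt,
    EReal.coe_lt_coe_iff] at h

theorem quantile_one_sub {p : ℝ} (hp : p ∈ Set.Ioo (0 : ℝ) 1) :
    quantile (1 - p) = -quantile p := by
  obtain ⟨y, rfl⟩ := exists_eq_Phi_coe hp
  rw [← Phi_neg_coe, quantile_Phi, quantile_Phi]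

theorem continuousAt_quantile {p : ℝ} (hp : p ∈ Set.Ioo (0 : ℝ) 1) : ContinuousAt quantile p := by
  obtain ⟨y, rfl⟩ := exists_eq_Phi_coe hp
  refine ContinuousAt.comp (EReal.tendsto_toReal ?_ ?_) continuous_PhiInv.continuousAt
  · rw [PhiInv_Phi]; exact EReal.coe_ne_top y
  · rw [PhiInv_Phi]; exact EReal.coe_ne_bot y

theorem hasDerivAt_quantile {p : ℝ} (hp : p ∈ Set.Ioo (0 : ℝ) 1) :
    HasDerivAt quantile (φ (quantile p))⁻¹ p := by
  refine (hasDerivAt_Phi _).of_local_left_inverse (continuousAt_quantile hp)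
    (stdGaussianPDFReal_pos _).ne' ?_
  filter_upwards [Ioo_mem_nhds hp.1 hp.2] with y hy using Phi_quantile hy

/-! ### The isoperimetric profile -/

/-- The Gaussian isoperimetric profile `I = φ ∘ Φ⁻¹` on `(0, 1)`, extended by `0`. The half-space
of measure `p` has Gaussian boundary measure `I p`. -/
noncomputable def isoProfile : ℝ → ℝ := (Set.Ioo 0 1).indicator fun p => φ (quantile p)

theorem isoProfile_of_mem {p : ℝ} (hp : p ∈ Set.Ioo (0 : ℝ) 1) : isoProfile p = φ (quantile p) :=
  Set.indicator_of_mem hp _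

theorem isoProfile_of_notMem {p : ℝ} (hp : p ∉ Set.Ioo (0 : ℝ) 1) : isoProfile p = 0 :=
  Set.indicator_of_notMem hp _

theorem isoProfile_zero : isoProfile 0 = 0 := isoProfile_of_notMem (by simp)

theorem isoProfile_one : isoProfile 1 = 0 := isoProfile_of_notMem (by simp)

theorem isoProfile_nonneg (p : ℝ) : 0 ≤ isoProfile p :=
  Set.indicator_nonneg (fun _ _ => gaussianPDFReal_nonneg 0 1 _) p

theorem isoProfile_le_one (p : ℝ) : isoProfile p ≤ 1 :=
  Set.indicator_apply_le' (fun _ => stdGaussianPDFReal_le_one _) fun _ => zero_le_one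

theorem one_sub_mem_Ioo_iff {p : ℝ} : 1 - p ∈ Set.Ioo (0 : ℝ) 1 ↔ p ∈ Set.Ioo (0 : ℝ) 1 := by
  rw [Set.sub_mem_Ioo_iff_right, sub_zero, sub_self]

theorem isoProfile_one_sub (p : ℝ) : isoProfile (1 - p) = isoProfile p := by
  by_cases hp : p ∈ Set.Ioo (0 : ℝ) 1
  · rw [isoProfile_of_mem hp, isoProfile_of_mem (one_sub_mem_Ioo_iff.2 hp), quantile_one_sub hp,
      stdGaussianPDFReal_neg]
  · rw [isoProfile_of_notMem hp, isoProfile_of_notMem (mt one_sub_mem_Ioo_iff.1 hp)]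

theorem hasDerivAt_isoProfile {p : ℝ} (hp : p ∈ Set.Ioo (0 : ℝ) 1) :
    HasDerivAt isoProfile (-quantile p) p := by
  have h := (hasDerivAt_stdGaussianPDFReal (quantile p)).comp p (hasDerivAt_quantile hp)
  rw [mul_inv_cancel_right₀ (stdGaussianPDFReal_pos _).ne'] at h
  refine h.congr_of_eventuallyEq ?_
  filter_upwards [Ioo_mem_nhds hp.1 hp.2] with y hy using isoProfile_of_mem hy

theorem isoProfile_le_of_le_PhiInv {p y : ℝ} (hy : 0 ≤ y) (h : (y : EReal) ≤ PhiInv p) :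
    isoProfile p ≤ φ y := by
  refine Set.indicator_apply_le' (fun hp => ?_) fun _ => gaussianPDFReal_nonneg 0 1 y
  obtain ⟨z, rfl⟩ := exists_eq_Phi_coe hp
  rw [PhiInv_Phi, EReal.coe_le_coe_iff] at h
  rw [quantile_Phi]
  exact stdGaussianPDFReal_le_of_abs_le (abs_le_abs_of_nonneg hy h)

theorem continuousAt_isoProfile_of_one_le {p : ℝ} (hp : 1 ≤ p) : ContinuousAt isoProfile p := by
  rw [ContinuousAt, isoProfile_of_notMem fun h => h.2.not_ge hp]
  refine tendsto_order.2 ⟨fun a ha => Eventually.of_forall fun p' =>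
    ha.trans_le (isoProfile_nonneg p'), fun a ha => ?_⟩
  obtain ⟨y, hy0, hy⟩ := ((eventually_ge_atTop 0).and
    ((tendsto_gaussianPDFReal_atTop 0 one_ne_zero).eventually (gt_mem_nhds ha))).exists
  filter_upwards [continuous_PhiInv.continuousAt.eventually_const_lt
    (PhiInv_of_one_le hp ▸ EReal.coe_lt_top y)] with p' hp'
  exact (isoProfile_le_of_le_PhiInv hy0 hp'.le).trans_lt hy

theorem continuous_isoProfile : Continuous isoProfile := by
  refine continuous_iff_continuousAt.2 fun p => ?_
  rcases le_or_gt 1 p with h1 | h1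
  · exact continuousAt_isoProfile_of_one_le h1
  rcases le_or_gt p 0 with h0 | h0
  · have hreflect : isoProfile = isoProfile ∘ fun p => 1 - p :=
      funext fun p => (isoProfile_one_sub p).symm
    rw [hreflect]
    exact (continuousAt_isoProfile_of_one_le (by linarith)).comp (by fun_prop)
  · exact (hasDerivAt_isoProfile ⟨h0, h1⟩).continuousAt

theorem concaveOn_isoProfile : ConcaveOn ℝ (Set.Icc 0 1) isoProfile := by
  refine AntitoneOn.concaveOn_of_deriv (convex_Icc 0 1) continuous_isoProfile.continuousOn ?_ ?_
  · rw [interior_Icc]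
    exact fun p hp => (hasDerivAt_isoProfile hp).differentiableAt.differentiableWithinAt
  · rw [interior_Icc]
    intro p hp p' hp' h
    rw [(hasDerivAt_isoProfile hp).deriv, (hasDerivAt_isoProfile hp').deriv]
    exact neg_le_neg (strictMonoOn_quantile.monotoneOn hp hp' h)

/-! ### Bobkov's two-point inequality -/

theorem nonneg_of_hasDerivAt_nonneg {f f' : ℝ → ℝ} {b : ℝ}
    (hf : ∀ t ∈ Set.Icc 0 b, HasDerivAt f (f' t) t) (h0 : 0 ≤ f 0)
    (hf' : ∀ t ∈ Set.Icc 0 b, 0 ≤ f' t) : ∀ t ∈ Set.Icc 0 b, 0 ≤ f t := by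
  intro t ht
  have hmono : MonotoneOn f (Set.Icc 0 b) :=
    monotoneOn_of_hasDerivWithinAt_nonneg (convex_Icc 0 b)
      (fun s hs => (hf s hs).continuousAt.continuousWithinAt)
      (fun s hs => (hf s (interior_subset hs)).hasDerivWithinAt)
      fun s hs => hf' s (interior_subset hs)
  exact h0.trans (hmono ⟨le_rfl, ht.1.trans ht.2⟩ ht ht.1)

section SecondDerivative

variable {F F' F'' : ℝ → ℝ} {c x : ℝ}

theorem add_mem_Icc_sub_add {t : ℝ} (ht : t ∈ Set.Icc 0 x) : c + t ∈ Set.Icc (c - x) (c + x) :=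
  ⟨by linarith [ht.1, ht.2], by linarith [ht.2]⟩

theorem sub_mem_Icc_sub_add {t : ℝ} (ht : t ∈ Set.Icc 0 x) : c - t ∈ Set.Icc (c - x) (c + x) :=
  ⟨by linarith [ht.2], by linarith [ht.1, ht.2]⟩

theorem mul_sq_le_add_sub_of_hasDerivAt (hx : 0 ≤ x)
    (hF : ∀ p ∈ Set.Icc (c - x) (c + x), HasDerivAt F (F' p) p)
    (hF' : ∀ p ∈ Set.Icc (c - x) (c + x), HasDerivAt F' (F'' p) p) {m : ℝ}
    (h : ∀ t ∈ Set.Icc 0 x, 2 * m ≤ F'' (c + t) + F'' (c - t)) :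
    m * x ^ 2 ≤ F (c + x) + F (c - x) - 2 * F c := by
  have hderiv : ∀ t ∈ Set.Icc 0 x, 0 ≤ F' (c + t) - F' (c - t) - 2 * m * t := by
    refine nonneg_of_hasDerivAt_nonneg (fun t ht =>
      (((hF' _ (add_mem_Icc_sub_add ht)).comp_const_add c t).sub
        ((hF' _ (sub_mem_Icc_sub_add ht)).comp_const_sub c t)).sub
          ((hasDerivAt_id t).const_mul (2 * m))) (by simp) fun t ht => ?_
    linarith [h t ht]
  have hmain : ∀ t ∈ Set.Icc 0 x, 0 ≤ F (c + t) + F (c - t) - m * t ^ 2 - 2 * F c := by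
    refine nonneg_of_hasDerivAt_nonneg (fun t ht =>
      ((((hF _ (add_mem_Icc_sub_add ht)).comp_const_add c t).add
        ((hF _ (sub_mem_Icc_sub_add ht)).comp_const_sub c t)).sub
          ((hasDerivAt_pow 2 t).const_mul m)).sub_const _) (le_of_eq (by simp; ring))
      fun t ht => ?_
    simpa [mul_assoc, mul_left_comm m, ← sub_eq_add_neg] using hderiv t ht
  linarith [hmain x ⟨hx, le_rfl⟩]

theorem sub_le_mul_of_hasDerivAt (hx : 0 ≤ x)
    (hF : ∀ p ∈ Set.Icc (c - x) (c + x), HasDerivAt F (F' p) p)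
    (hF' : ∀ p ∈ Set.Icc (c - x) (c + x), HasDerivAt F' (F'' p) p)
    (h : ∀ t ∈ Set.Icc 0 x, F'' (c + t) ≤ F'' (c - t)) :
    F (c + x) - F (c - x) ≤ 2 * F' c * x := by
  have hderiv : ∀ t ∈ Set.Icc 0 x, 0 ≤ 2 * F' c - (F' (c + t) + F' (c - t)) := by
    refine nonneg_of_hasDerivAt_nonneg (fun t ht =>
      (((hF' _ (add_mem_Icc_sub_add ht)).comp_const_add c t).add
        ((hF' _ (sub_mem_Icc_sub_add ht)).comp_const_sub c t)).const_sub _)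
      (le_of_eq (by simp; ring)) fun t ht => ?_
    linarith [h t ht]
  have hmain : ∀ t ∈ Set.Icc 0 x, 0 ≤ 2 * F' c * t - (F (c + t) - F (c - t)) := by
    refine nonneg_of_hasDerivAt_nonneg (fun t ht =>
      ((hasDerivAt_id t).const_mul (2 * F' c)).sub
        (((hF _ (add_mem_Icc_sub_add ht)).comp_const_add c t).sub
          ((hF _ (sub_mem_Icc_sub_add ht)).comp_const_sub c t))) (by simp) fun t ht => ?_
    linarith [hderiv t ht]
  linarith [hmain x ⟨hx, le_rfl⟩]

end SecondDerivative

theorem monotone_div_stdGaussianPDFReal : Monotone fun y : ℝ => y / φ y := by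
  refine monotone_of_hasDerivAt_nonneg
    (fun y => (hasDerivAt_id y).div (hasDerivAt_stdGaussianPDFReal y)
      (stdGaussianPDFReal_pos y).ne') fun y => div_nonneg ?_ (sq_nonneg _)
  have h : 1 * φ y - id y * (-y * φ y) = (1 + y ^ 2) * φ y := by simp only [id]; ring
  rw [h]
  exact mul_nonneg (by positivity) (stdGaussianPDFReal_pos y).le

theorem hasDerivAt_quantile_sq {p : ℝ} (hp : p ∈ Set.Ioo (0 : ℝ) 1) :
    HasDerivAt (fun p => quantile p ^ 2) (2 * (quantile p / φ (quantile p))) p :=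
  ((hasDerivAt_quantile hp).pow 2).congr_deriv (by simp [div_eq_mul_inv, mul_assoc])

theorem convexOn_quantile_sq : ConvexOn ℝ (Set.Ioo 0 1) fun p => quantile p ^ 2 := by
  refine MonotoneOn.convexOn_of_deriv (convex_Ioo 0 1)
    (fun p hp => (hasDerivAt_quantile_sq hp).continuousAt.continuousWithinAt) ?_ ?_
  · exact fun p hp => (hasDerivAt_quantile_sq (interior_subset hp)).differentiableAt
      |>.differentiableWithinAt
  · intro p hp p' hp' h
    have hp := interior_subset hp
    have hp' := interior_subset hp'
    rw [(hasDerivAt_quantile_sq hp).deriv, (hasDerivAt_quantile_sq hp').deriv]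
    exact mul_le_mul_of_nonneg_left
      (monotone_div_stdGaussianPDFReal (strictMonoOn_quantile.monotoneOn hp hp' h)) zero_le_two

theorem hasDerivAt_isoProfile_sq {p : ℝ} (hp : p ∈ Set.Ioo (0 : ℝ) 1) :
    HasDerivAt (fun p => isoProfile p ^ 2) (-2 * isoProfile p * quantile p) p :=
  ((hasDerivAt_isoProfile hp).pow 2).congr_deriv (by simp)

theorem hasDerivAt_isoProfile_mul_quantile {p : ℝ} (hp : p ∈ Set.Ioo (0 : ℝ) 1) :
    HasDerivAt (fun p => -2 * isoProfile p * quantile p) (2 * quantile p ^ 2 - 2) p := by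
  refine (((hasDerivAt_isoProfile hp).const_mul (-2)).mul (hasDerivAt_quantile hp)).congr_deriv ?_
  have : isoProfile p * (φ (quantile p))⁻¹ = 1 := by
    rw [isoProfile_of_mem hp, mul_inv_cancel₀ (stdGaussianPDFReal_pos _).ne']
  linear_combination (-2) * this

section TwoPoint

variable {c x : ℝ}

theorem Icc_sub_add_subset_Ioo (hm : 0 < c - x) (hp : c + x < 1) :
    Set.Icc (c - x) (c + x) ⊆ Set.Ioo 0 1 := fun _ h => ⟨hm.trans_le h.1, h.2.trans_lt hp⟩

theorem two_mul_quantile_sq_mul_sq_le (hx : 0 ≤ x) (hm : 0 < c - x) (hp : c + x < 1) :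
    2 * quantile c ^ 2 * x ^ 2 ≤
      isoProfile (c + x) ^ 2 + isoProfile (c - x) ^ 2 + 2 * x ^ 2 - 2 * isoProfile c ^ 2 := by
  have hsub := Icc_sub_add_subset_Ioo hm hp
  have h := mul_sq_le_add_sub_of_hasDerivAt (m := 2 * quantile c ^ 2 - 2) hx
    (fun p h => hasDerivAt_isoProfile_sq (hsub h))
    (fun p h => hasDerivAt_isoProfile_mul_quantile (hsub h)) fun t ht => by
      have hmid := convexOn_quantile_sq.2 (hsub (add_mem_Icc_sub_add ht))
        (hsub (sub_mem_Icc_sub_add ht)) (by norm_num) (by norm_num) (add_halves (1 : ℝ))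
      have hc : (1 / 2 : ℝ) • (c + t) + (1 / 2 : ℝ) • (c - t) = c := by
        simp only [smul_eq_mul]; ring
      rw [hc] at hmid
      simp only [smul_eq_mul] at hmid
      linarith
  linarith

theorem isoProfile_sq_sub_le (hc : c ≤ 1 / 2) (hx : 0 ≤ x) (hm : 0 < c - x) (hp : c + x < 1) :
    isoProfile (c + x) ^ 2 - isoProfile (c - x) ^ 2 ≤ -4 * isoProfile c * quantile c * x := by
  have hsub := Icc_sub_add_subset_Ioo hm hp
  have h := sub_le_mul_of_hasDerivAt hx (fun p h => hasDerivAt_isoProfile_sq (hsub h))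
    (fun p h => hasDerivAt_isoProfile_mul_quantile (hsub h)) fun t ht => by
      have hmem := hsub (sub_mem_Icc_sub_add ht)
      have hmax := convexOn_quantile_sq.le_max_of_mem_Icc hmem (one_sub_mem_Ioo_iff.2 hmem)
        (z := c + t) ⟨by linarith [ht.1], by linarith⟩
      simp only [quantile_one_sub hmem, neg_sq, max_self] at hmax
      linarith
  linarith

theorem isoProfile_sub_le_add (hc : c ≤ 1 / 2) (hx : 0 ≤ x) (hm : 0 ≤ c - x) :
    isoProfile (c - x) ≤ isoProfile (c + x) := by
  have h := concaveOn_isoProfile.min_le_of_mem_Icc (x := c - x) (y := 1 - (c - x)) (z := c + x)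
    ⟨hm, by linarith⟩ ⟨by linarith, by linarith⟩ ⟨by linarith, by linarith⟩
  rwa [isoProfile_one_sub, min_self] at h

theorem two_mul_le_add_of_sq_sub_sq {a b j : ℝ} (ha : 0 ≤ a) (hb : 0 ≤ b)
    (h : (a ^ 2 - b ^ 2) ^ 2 ≤ 8 * j ^ 2 * (a ^ 2 + b ^ 2 - 2 * j ^ 2)) : 2 * j ≤ a + b := by
  by_contra! hlt
  have hsum : 0 < 4 * j ^ 2 - (a + b) ^ 2 := by nlinarith
  have hdiff : 0 < 4 * j ^ 2 - (a - b) ^ 2 := by nlinarith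
  have hfactor : (4 * j ^ 2 - (a + b) ^ 2) * (4 * j ^ 2 - (a - b) ^ 2) =
      (a ^ 2 - b ^ 2) ^ 2 - 8 * j ^ 2 * (a ^ 2 + b ^ 2 - 2 * j ^ 2) := by ring
  linarith [(mul_pos hsum hdiff).trans_eq hfactor]

theorem two_mul_isoProfile_le_of_le_half (hc : c ≤ 1 / 2) (hx : 0 ≤ x) (hm : 0 < c - x)
    (hp : c + x < 1) :
    2 * isoProfile c ≤ √(isoProfile (c + x) ^ 2 + x ^ 2) + √(isoProfile (c - x) ^ 2 + x ^ 2) := by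
  refine two_mul_le_add_of_sq_sub_sq (Real.sqrt_nonneg _) (Real.sqrt_nonneg _) ?_
  rw [Real.sq_sqrt (by positivity), Real.sq_sqrt (by positivity)]
  have hsq : isoProfile (c - x) ^ 2 ≤ isoProfile (c + x) ^ 2 :=
    pow_le_pow_left₀ (isoProfile_nonneg _) (isoProfile_sub_le_add hc hx hm.le) 2
  calc _ = (isoProfile (c + x) ^ 2 - isoProfile (c - x) ^ 2) ^ 2 := by ring
    _ ≤ (-4 * isoProfile c * quantile c * x) ^ 2 :=
        pow_le_pow_left₀ (by linarith) (isoProfile_sq_sub_le hc hx hm hp) 2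
    _ = 8 * isoProfile c ^ 2 * (2 * quantile c ^ 2 * x ^ 2) := by ring
    _ ≤ 8 * isoProfile c ^ 2 * (isoProfile (c + x) ^ 2 + isoProfile (c - x) ^ 2 + 2 * x ^ 2
        - 2 * isoProfile c ^ 2) := by gcongr; exact two_mul_quantile_sq_mul_sq_le hx hm hp
    _ = _ := by ring

theorem two_mul_isoProfile_le (hx : 0 ≤ x) (hm : 0 < c - x) (hp : c + x < 1) :
    2 * isoProfile c ≤ √(isoProfile (c + x) ^ 2 + x ^ 2) + √(isoProfile (c - x) ^ 2 + x ^ 2) := by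
  rcases le_total c (1 / 2) with hc | hc
  · exact two_mul_isoProfile_le_of_le_half hc hx hm hp
  · have h := two_mul_isoProfile_le_of_le_half (c := 1 - c) (x := x) (by linarith) hx
      (by linarith) (by linarith)
    rwa [isoProfile_one_sub, sub_add, sub_sub 1 c x, isoProfile_one_sub, isoProfile_one_sub,
      add_comm] at h

end TwoPoint

theorem bobkov_two_point_of_mem_Ioo {a b : ℝ} (ha : a ∈ Set.Ioo (0 : ℝ) 1)
    (hb : b ∈ Set.Ioo (0 : ℝ) 1) :
    2 * isoProfile ((a + b) / 2) ≤ √(isoProfile a ^ 2 + ((a - b) / 2) ^ 2)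
      + √(isoProfile b ^ 2 + ((a - b) / 2) ^ 2) := by
  wlog h : b ≤ a generalizing a b
  · have := this hb ha (le_of_not_ge h)
    rwa [add_comm b a, ← neg_sub a b, neg_div, neg_sq, add_comm √_] at this
  have := two_mul_isoProfile_le (c := (a + b) / 2) (x := (a - b) / 2) (by linarith)
    (by linarith [hb.1]) (by linarith [ha.2])
  rwa [← add_div, ← sub_div, add_add_sub_cancel, add_sub_sub_cancel, add_self_div_two,
    add_self_div_two] at this

theorem bobkov_two_point {a b : ℝ} (ha : a ∈ Set.Icc (0 : ℝ) 1) (hb : b ∈ Set.Icc (0 : ℝ) 1) :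
    2 * isoProfile ((a + b) / 2) ≤ √(isoProfile a ^ 2 + ((a - b) / 2) ^ 2)
      + √(isoProfile b ^ 2 + ((a - b) / 2) ^ 2) := by
  have hI := continuous_isoProfile
  have hab : (a, b) ∈ closure (Set.Ioo (0 : ℝ) 1 ×ˢ Set.Ioo (0 : ℝ) 1) := by
    rw [closure_prod_eq, closure_Ioo zero_ne_one]
    exact ⟨ha, hb⟩
  exact le_on_closure (f := fun q : ℝ × ℝ => 2 * isoProfile ((q.1 + q.2) / 2))
    (g := fun q => √(isoProfile q.1 ^ 2 + ((q.1 - q.2) / 2) ^ 2)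
      + √(isoProfile q.2 ^ 2 + ((q.1 - q.2) / 2) ^ 2))
    (fun q hq => bobkov_two_point_of_mem_Ioo hq.1 hq.2) (by fun_prop) (by fun_prop) hab

/-! ### Bobkov's inequality on the discrete cube -/

theorem sqrt_expect_sq_add_expect_sq_le {α : Type*} (s : Finset α) (A B : α → ℝ) :
    √((𝔼 x ∈ s, A x) ^ 2 + (𝔼 x ∈ s, B x) ^ 2) ≤ 𝔼 x ∈ s, √(A x ^ 2 + B x ^ 2) := by
  have h := RCLike.norm_expect_le (K := ℝ) (s := s) (f := fun x => (A x + B x * Complex.I : ℂ))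
  rw [Finset.expect_add_distrib, ← Finset.expect_mul, ← Complex.ofReal_expect,
    ← Complex.ofReal_expect, Complex.norm_add_mul_I] at h
  simpa only [Complex.norm_add_mul_I] using h

theorem expect_mem_Icc {α : Type*} [Fintype α] [Nonempty α] {f : α → ℝ} {a b : ℝ}
    (hf : ∀ x, f x ∈ Set.Icc a b) : 𝔼 x, f x ∈ Set.Icc a b :=
  ⟨Finset.le_expect Finset.univ_nonempty fun x _ => (hf x).1,
    Finset.expect_le Finset.univ_nonempty fun x _ => (hf x).2⟩

theorem expect_cube_succ {N : ℕ} (g : (Fin (N + 1) → Bool) → ℝ) :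
    𝔼 x, g x = (𝔼 y, g (Fin.cons true y) + 𝔼 y, g (Fin.cons false y)) / 2 := by
  rw [← Fintype.expect_equiv (Fin.consEquiv fun _ : Fin (N + 1) => Bool)
    (fun q => g (Fin.cons q.1 q.2)) g fun _ => rfl, ← Finset.univ_product_univ,
    Finset.expect_product, Fintype.expect_eq_sum_div_card, Fintype.sum_bool, Fintype.card_bool,
    Nat.cast_ofNat]

/-- The squared norm of the discrete gradient of `f` on the cube `{false, true}^ι`: the directional
derivative along `i` is half the increment of `f` when the coordinate `i` is flipped. -/
noncomputable def cubeGradSq {ι : Type*} [Fintype ι] [DecidableEq ι] (f : (ι → Bool) → ℝ)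
    (x : ι → Bool) : ℝ :=
  ∑ i, ((f x - f (Function.update x i (!x i))) / 2) ^ 2

theorem cubeGradSq_nonneg {ι : Type*} [Fintype ι] [DecidableEq ι] (f : (ι → Bool) → ℝ)
    (x : ι → Bool) : 0 ≤ cubeGradSq f x := Finset.sum_nonneg fun _ _ => sq_nonneg _

theorem cubeGradSq_cons {N : ℕ} (f : (Fin (N + 1) → Bool) → ℝ) (b : Bool) (y : Fin N → Bool) :
    cubeGradSq f (Fin.cons b y) =
      cubeGradSq (fun y => f (Fin.cons b y)) y
        + ((f (Fin.cons true y) - f (Fin.cons false y)) / 2) ^ 2 := by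
  simp only [cubeGradSq, Fin.sum_univ_succ, Fin.cons_zero, Fin.cons_succ, Fin.update_cons_zero,
    ← Fin.cons_update]
  rw [add_comm]
  congr 1
  cases b
  · simp only [Bool.not_false]; ring
  · simp only [Bool.not_true]

theorem cubeGradSq_comp_equiv {ι κ : Type*} [Fintype ι] [DecidableEq ι] [Fintype κ]
    [DecidableEq κ] (e : ι ≃ κ) (f : (ι → Bool) → ℝ) (x : κ → Bool) :
    cubeGradSq (fun y => f (y ∘ e)) x = cubeGradSq f (x ∘ e) := by
  refine (Fintype.sum_equiv e _ _ fun i => ?_).symm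
  simp only [Function.update_comp_equiv, e.symm_apply_apply, Function.comp_apply]

theorem isoProfile_mean_le_of_fibers {Ω : Type*} [Fintype Ω] {f A : Bool → Ω → ℝ}
    (hmean : ∀ b, 𝔼 y, f b y ∈ Set.Icc (0 : ℝ) 1)
    (hA : ∀ b, isoProfile (𝔼 y, f b y) ≤ 𝔼 y, A b y) :
    isoProfile ((𝔼 y, f true y + 𝔼 y, f false y) / 2) ≤
      (𝔼 y, √(A true y ^ 2 + ((f true y - f false y) / 2) ^ 2)
        + 𝔼 y, √(A false y ^ 2 + ((f true y - f false y) / 2) ^ 2)) / 2 := by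
  have hdiff : (𝔼 y, f true y - 𝔼 y, f false y) / 2 = 𝔼 y, (f true y - f false y) / 2 := by
    rw [← Finset.expect_div, Finset.expect_sub_distrib]
  have hfiber (b : Bool) :
      √(isoProfile (𝔼 y, f b y) ^ 2 + ((𝔼 y, f true y - 𝔼 y, f false y) / 2) ^ 2) ≤
        𝔼 y, √(A b y ^ 2 + ((f true y - f false y) / 2) ^ 2) := by
    rw [hdiff]
    refine le_trans ?_ (sqrt_expect_sq_add_expect_sq_le _ _ _)
    gcongr
    exacts [isoProfile_nonneg _, hA b]
  linarith [bobkov_two_point (hmean true) (hmean false), hfiber true, hfiber false]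

theorem bobkov_cube_fin {N : ℕ} {f : (Fin N → Bool) → ℝ} (hf : ∀ x, f x ∈ Set.Icc (0 : ℝ) 1) :
    isoProfile (𝔼 x, f x) ≤ 𝔼 x, √(isoProfile (f x) ^ 2 + cubeGradSq f x) := by
  induction N with
  | zero => simp [cubeGradSq, Real.sqrt_sq (isoProfile_nonneg _)]
  | succ N ih =>
    rw [expect_cube_succ, expect_cube_succ]
    refine (isoProfile_mean_le_of_fibers (f := fun b y => f (Fin.cons b y))
      (fun b => expect_mem_Icc fun y => hf _) fun b => ih fun y => hf _).trans_eq ?_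
    simp only [cubeGradSq_cons, ← add_assoc,
      Real.sq_sqrt (add_nonneg (sq_nonneg _) (cubeGradSq_nonneg _ _))]

theorem bobkov_cube {ι : Type*} [Fintype ι] [DecidableEq ι] {f : (ι → Bool) → ℝ}
    (hf : ∀ x, f x ∈ Set.Icc (0 : ℝ) 1) :
    isoProfile (𝔼 x, f x) ≤ 𝔼 x, √(isoProfile (f x) ^ 2 + cubeGradSq f x) := by
  let e := Fintype.equivFin ι
  have hexpect (g : (ι → Bool) → ℝ) : 𝔼 x, g x = 𝔼 y, g (y ∘ e) :=
    (Fintype.expect_equiv (e.symm.arrowCongr (Equiv.refl Bool)) _ _ fun _ => rfl).symm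
  rw [hexpect, hexpect]
  simpa only [cubeGradSq_comp_equiv] using bobkov_cube_fin fun y => hf (y ∘ e)

/-! ### Normalized sums of random signs -/

theorem integral_uniformOn_univ {Ω F : Type*} [Fintype Ω] [MeasurableSpace Ω]
    [MeasurableSingletonClass Ω] [NormedAddCommGroup F] [NormedSpace ℝ F] [CompleteSpace F]
    [Module ℚ≥0 F] (g : Ω → F) : ∫ x, g x ∂(uniformOn Set.univ) = 𝔼 x, g x := by
  have hsingleton (x : Ω) : (uniformOn Set.univ).real {x} = (Fintype.card Ω : ℝ)⁻¹ := by
    rw [measureReal_def, uniformOn_univ, Measure.count_singleton, ENNReal.toReal_div,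
      ENNReal.toReal_one, ENNReal.toReal_natCast, one_div]
  rw [integral_fintype Integrable.of_finite, Finset.expect, Finset.smul_sum]
  refine Finset.sum_congr rfl fun x _ => ?_
  rw [hsingleton, Finset.card_univ, ← NNRat.cast_smul_eq_nnqsmul ℝ]
  simp

/-- The sign `±1` encoded by a bit. -/
def bitSign (b : Bool) : ℝ := if b then 1 else -1

theorem bitSign_not (b : Bool) : bitSign (!b) = -bitSign b := by cases b <;> simp [bitSign]

theorem abs_bitSign (b : Bool) : |bitSign b| = 1 := by cases b <;> simp [bitSign]

theorem tendsto_charFun_bitSign_pow (t : ℝ) :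
    Tendsto (fun n : ℕ => charFun ((uniformOn Set.univ).map bitSign) ((√n)⁻¹ * t) ^ n) atTop
      (𝓝 (Complex.exp (-t ^ 2 / 2))) := by
  have hmean : ∫ b, bitSign b ∂(uniformOn Set.univ) = 0 := by
    rw [integral_uniformOn_univ, Fintype.expect_eq_sum_div_card, Fintype.sum_bool]
    simp [bitSign]
  have hsq : ∫ b, (bitSign ^ 2) b ∂(uniformOn Set.univ) = 1 := by
    simp only [Pi.pow_apply, ← sq_abs (bitSign _), abs_bitSign, one_pow, integral_const,
      probReal_univ, smul_eq_mul, mul_one]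
  exact tendsto_charFun_inv_sqrt_mul_pow Measurable.of_discrete.aemeasurable hmean hsq t

section SignSum

variable {E κ : Type*} [NormedAddCommGroup E] [InnerProductSpace ℝ E] [Fintype κ]

/-- The normalized sum of signs along an orthonormal basis `b`: the `j`-th coordinate is
`(∑ k, ± 1) / √n`, which is approximately Gaussian for uniformly random signs. -/
noncomputable def signSum (b : OrthonormalBasis κ ℝ E) (n : ℕ) (x : κ × Fin n → Bool) : E :=
  ∑ p, ((√n)⁻¹ * bitSign (x p)) • b p.1

theorem charFun_map_signSum [MeasurableSpace E] [BorelSpace E] (b : OrthonormalBasis κ ℝ E)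
    (n : ℕ) (t : E) :
    charFun ((uniformOn Set.univ).map (signSum b n)) t =
      ∏ j, charFun ((uniformOn Set.univ).map bitSign) ((√n)⁻¹ * ⟪b j, t⟫) ^ n := by
  have hpi : uniformOn (Set.univ : Set (κ × Fin n → Bool)) =
      Measure.pi fun _ => uniformOn Set.univ := by
    rw [← uniformOn_pi, Set.pi_univ]
  have hexp (x : κ × Fin n → Bool) : Complex.exp (⟪signSum b n x, t⟫ * Complex.I) =
      ∏ p, Complex.exp (((√n)⁻¹ * ⟪b p.1, t⟫ : ℝ) * bitSign (x p) * Complex.I) := by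
    rw [← Complex.exp_sum, signSum, sum_inner, Complex.ofReal_sum, Finset.sum_mul]
    simp only [inner_smul_left, RCLike.conj_to_real, Complex.ofReal_mul, mul_right_comm]
  have hbit (s : ℝ) : charFun ((uniformOn Set.univ).map bitSign) s =
      ∫ v, Complex.exp (s * bitSign v * Complex.I) ∂(uniformOn Set.univ) := by
    rw [charFun_apply_real, integral_map Measurable.of_discrete.aemeasurable (by fun_prop)]
  rw [charFun_apply, integral_map Measurable.of_discrete.aemeasurable (by fun_prop), hpi]
  simp only [hexp, hbit]
  rw [integral_fintype_prod_eq_prod fun (p : κ × Fin n) (v : Bool) =>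
    Complex.exp (((√n)⁻¹ * ⟪b p.1, t⟫ : ℝ) * bitSign v * Complex.I), Fintype.prod_prod_type]
  simp only [Finset.prod_const, Finset.card_univ, Fintype.card_fin]

theorem tendsto_expect_signSum [DecidableEq κ] [FiniteDimensional ℝ E] [MeasurableSpace E]
    [BorelSpace E]
    (b : OrthonormalBasis κ ℝ E) {g : E → ℝ} (hg : Continuous g) {C : ℝ} (hC : ∀ y, ‖g y‖ ≤ C) :
    Tendsto (fun n => 𝔼 x, g (signSum b n x)) atTop (𝓝 (∫ y, g y ∂(stdGaussian E))) := by
  have hmeas (n : ℕ) : AEMeasurable (signSum b n) (uniformOn Set.univ) :=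
    Measurable.of_discrete.aemeasurable
  let P (n : ℕ) : ProbabilityMeasure E :=
    ⟨(uniformOn Set.univ).map (signSum b n), Measure.isProbabilityMeasure_map (hmeas n)⟩
  let Q : ProbabilityMeasure E := ⟨stdGaussian E, inferInstance⟩
  have hPQ : Tendsto P atTop (𝓝 Q) := by
    refine ProbabilityMeasure.tendsto_iff_tendsto_charFun.2 fun t => ?_
    have hprod := tendsto_finsetProd Finset.univ
      fun j (_ : j ∈ Finset.univ) => tendsto_charFun_bitSign_pow ⟪b j, t⟫
    simp only [P, Q, ProbabilityMeasure.coe_mk, charFun_map_signSum, charFun_stdGaussian]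
    convert hprod using 2
    rw [← Complex.exp_sum, ← Finset.sum_div, Finset.sum_neg_distrib, ← Complex.ofReal_pow,
      ← b.sum_sq_inner_right]
    push_cast
    rfl
  refine (ProbabilityMeasure.tendsto_iff_forall_integral_tendsto.1 hPQ
    (BoundedContinuousFunction.ofNormedAddCommGroup g hg C hC)).congr fun n => ?_
  exact (integral_map (hmeas n) hg.aestronglyMeasurable).trans (integral_uniformOn_univ _)

end SignSum

/-! ### Bobkov's inequality for the standard Gaussian measure -/

theorem sqrt_sq_add_add_sq_le (a : ℝ) {b e : ℝ} (he : 0 ≤ e) :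
    √(a ^ 2 + (b + e) ^ 2) ≤ √(a ^ 2 + b ^ 2) + e := by
  have hb : b ≤ √(a ^ 2 + b ^ 2) :=
    (le_abs_self b).trans (Real.abs_le_sqrt (le_add_of_nonneg_left (sq_nonneg a)))
  refine Real.sqrt_le_iff.2 ⟨by positivity, ?_⟩
  rw [add_sq (√_), Real.sq_sqrt (by positivity)]
  nlinarith [mul_le_mul_of_nonneg_left hb he]

theorem norm_sub_le_of_lipschitzWith_fderiv {E F : Type*} [NormedAddCommGroup E]
    [NormedSpace ℝ E] [NormedAddCommGroup F] [NormedSpace ℝ F] {f : E → F}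
    (hf : Differentiable ℝ f) {M : NNReal} (hM : LipschitzWith M (fderiv ℝ f)) (y z : E) :
    ‖f z - f y‖ ≤ ‖fderiv ℝ f y (z - y)‖ + M * ‖z - y‖ ^ 2 := by
  have hgrad (u : E) (hu : u ∈ Metric.closedBall y ‖z - y‖) :
      ‖fderiv ℝ f u - fderiv ℝ f y‖ ≤ M * ‖z - y‖ := by
    rw [← dist_eq_norm]
    exact (hM.dist_le_mul u y).trans (by gcongr; exact hu)
  have htaylor : ‖f z - f y - fderiv ℝ f y (z - y)‖ ≤ M * ‖z - y‖ * ‖z - y‖ :=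
    (convex_closedBall y _).norm_image_sub_le_of_norm_fderiv_le' (fun u _ => hf u) hgrad
      (Metric.mem_closedBall_self (norm_nonneg _)) (by rw [mem_closedBall_iff_norm])
  calc ‖f z - f y‖ ≤ ‖f z - f y - fderiv ℝ f y (z - y)‖ + ‖fderiv ℝ f y (z - y)‖ :=
        norm_le_norm_sub_add _ _
    _ ≤ ‖fderiv ℝ f y (z - y)‖ + M * ‖z - y‖ ^ 2 := by linarith

theorem sum_abs_apply_orthonormalBasis_add_sq_le {E κ : Type*} [NormedAddCommGroup E]
    [InnerProductSpace ℝ E] [Fintype κ] (b : OrthonormalBasis κ ℝ E) (l : StrongDual ℝ E) {c : ℝ}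
    (hc : 0 ≤ c) : ∑ j, (|l (b j)| + c) ^ 2 ≤ (‖l‖ + Fintype.card κ * c) ^ 2 := by
  have hl (j : κ) : |l (b j)| ≤ ‖l‖ := by
    simpa only [Real.norm_eq_abs, b.norm_eq_one, mul_one] using l.le_opNorm (b j)
  have hcard : (Fintype.card κ : ℝ) ≤ Fintype.card κ ^ 2 := by
    exact_mod_cast Nat.le_self_pow two_ne_zero _
  calc ∑ j, (|l (b j)| + c) ^ 2 = ∑ j, (l (b j) ^ 2 + 2 * |l (b j)| * c + c ^ 2) := by
        simp only [add_sq, sq_abs]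
    _ ≤ ∑ j, (l (b j) ^ 2 + 2 * ‖l‖ * c + c ^ 2) := by gcongr with j; exact hl j
    _ = ‖l‖ ^ 2 + 2 * ‖l‖ * (Fintype.card κ * c) + Fintype.card κ * c ^ 2 := by
        simp only [Finset.sum_add_distrib, ← b.norm_dual, Finset.sum_const, Finset.card_univ,
          nsmul_eq_mul]
        ring
    _ ≤ ‖l‖ ^ 2 + 2 * ‖l‖ * (Fintype.card κ * c) + Fintype.card κ ^ 2 * c ^ 2 := by gcongr
    _ = (‖l‖ + Fintype.card κ * c) ^ 2 := by ring

section SignSum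

variable {E κ : Type*} [NormedAddCommGroup E] [InnerProductSpace ℝ E] [Fintype κ] [DecidableEq κ]

theorem signSum_update_sub (b : OrthonormalBasis κ ℝ E) (n : ℕ) (x : κ × Fin n → Bool)
    (p : κ × Fin n) :
    signSum b n (Function.update x p (!x p)) - signSum b n x =
      (-2 * (√n)⁻¹ * bitSign (x p)) • b p.1 := by
  rw [signSum, signSum, ← Finset.sum_sub_distrib, Finset.sum_eq_single p]
  · rw [← sub_smul, Function.update_self, bitSign_not]
    congr 1
    ring
  · intro q _ hq
    rw [Function.update_of_ne hq, sub_self]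
  · simp

theorem abs_sub_signSum_update_le (b : OrthonormalBasis κ ℝ E) {f : E → ℝ}
    (hf : Differentiable ℝ f) {M : NNReal} (hM : LipschitzWith M (fderiv ℝ f)) (n : ℕ)
    (x : κ × Fin n → Bool) (p : κ × Fin n) :
    |(f (signSum b n x) - f (signSum b n (Function.update x p (!x p)))) / 2| ≤
      (√n)⁻¹ * (|fderiv ℝ f (signSum b n x) (b p.1)| + 2 * M * (√n)⁻¹) := by
  have hcoef : |-2 * (√n)⁻¹ * bitSign (x p)| = 2 * (√n)⁻¹ := by
    rw [abs_mul, abs_bitSign, mul_one, abs_mul, abs_neg, abs_two, abs_of_nonneg (by positivity)]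
  have h := norm_sub_le_of_lipschitzWith_fderiv hf hM (signSum b n x)
    (signSum b n (Function.update x p (!x p)))
  rw [signSum_update_sub, map_smul, norm_smul, norm_smul, b.norm_eq_one, mul_one,
    Real.norm_eq_abs (_ * bitSign _), hcoef, Real.norm_eq_abs, Real.norm_eq_abs, abs_sub_comm] at h
  rw [abs_div, abs_two]
  linarith

theorem cubeGradSq_comp_signSum_le (b : OrthonormalBasis κ ℝ E) {f : E → ℝ}
    (hf : Differentiable ℝ f) {M : NNReal} (hM : LipschitzWith M (fderiv ℝ f)) (n : ℕ)
    (x : κ × Fin n → Bool) :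
    cubeGradSq (fun x => f (signSum b n x)) x ≤
      (‖fderiv ℝ f (signSum b n x)‖ + Fintype.card κ * (2 * M * (√n)⁻¹)) ^ 2 := by
  set l := fderiv ℝ f (signSum b n x)
  calc cubeGradSq (fun x => f (signSum b n x)) x
      ≤ ∑ p : κ × Fin n, ((√n)⁻¹ * (|l (b p.1)| + 2 * M * (√n)⁻¹)) ^ 2 :=
        Finset.sum_le_sum fun p _ => by
          rw [← sq_abs]
          gcongr
          exact abs_sub_signSum_update_le b hf hM n x p
    _ = ∑ j, n * (n : ℝ)⁻¹ * (|l (b j)| + 2 * M * (√n)⁻¹) ^ 2 := by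
        simp only [Fintype.sum_prod_type, Finset.sum_const, Finset.card_univ, Fintype.card_fin,
          nsmul_eq_mul, mul_pow, inv_pow, Real.sq_sqrt (Nat.cast_nonneg n), mul_assoc]
    _ ≤ ∑ j, (|l (b j)| + 2 * M * (√n)⁻¹) ^ 2 :=
        Finset.sum_le_sum fun j _ => mul_le_of_le_one_left (sq_nonneg _) mul_inv_le_one
    _ ≤ (‖l‖ + Fintype.card κ * (2 * M * (√n)⁻¹)) ^ 2 :=
        sum_abs_apply_orthonormalBasis_add_sq_le b l (by positivity)

theorem isoProfile_expect_signSum_le (b : OrthonormalBasis κ ℝ E) {f : E → ℝ}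
    (hf : Differentiable ℝ f) (hf01 : ∀ y, f y ∈ Set.Icc (0 : ℝ) 1) {M : NNReal}
    (hM : LipschitzWith M (fderiv ℝ f)) (n : ℕ) :
    isoProfile (𝔼 x, f (signSum b n x)) ≤
      𝔼 x, √(isoProfile (f (signSum b n x)) ^ 2 + ‖fderiv ℝ f (signSum b n x)‖ ^ 2) +
        Fintype.card κ * (2 * M * (√n)⁻¹) := by
  set e : ℝ := Fintype.card κ * (2 * M * (√n)⁻¹)
  have he : 0 ≤ e := by positivity
  calc isoProfile (𝔼 x, f (signSum b n x))
      ≤ 𝔼 x, √(isoProfile (f (signSum b n x)) ^ 2 + cubeGradSq (fun x => f (signSum b n x)) x) :=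
        bobkov_cube fun x => hf01 _
    _ ≤ 𝔼 x, (√(isoProfile (f (signSum b n x)) ^ 2 + ‖fderiv ℝ f (signSum b n x)‖ ^ 2) + e) := by
        gcongr with x
        refine le_trans ?_ (sqrt_sq_add_add_sq_le _ he)
        gcongr
        exact cubeGradSq_comp_signSum_le b hf hM n x
    _ = _ := by rw [Finset.expect_add_distrib, Fintype.expect_const]

end SignSum

theorem bobkov_stdGaussian {E : Type*} [NormedAddCommGroup E] [InnerProductSpace ℝ E]
    [FiniteDimensional ℝ E] [MeasurableSpace E] [BorelSpace E] {f : E → ℝ}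
    (hf : Differentiable ℝ f) (hf01 : ∀ y, f y ∈ Set.Icc (0 : ℝ) 1) {M : NNReal}
    (hM : LipschitzWith M (fderiv ℝ f)) {C : ℝ} (hC : ∀ y, ‖fderiv ℝ f y‖ ≤ C) :
    isoProfile (∫ y, f y ∂(stdGaussian E)) ≤
      ∫ y, √(isoProfile (f y) ^ 2 + ‖fderiv ℝ f y‖ ^ 2) ∂(stdGaussian E) := by
  let b := stdOrthonormalBasis ℝ E
  have hcont : Continuous fun y => √(isoProfile (f y) ^ 2 + ‖fderiv ℝ f y‖ ^ 2) := by
    have := continuous_isoProfile.comp hf.continuous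
    have := hM.continuous
    fun_prop
  have hbound (y : E) : ‖√(isoProfile (f y) ^ 2 + ‖fderiv ℝ f y‖ ^ 2)‖ ≤ √(1 ^ 2 + C ^ 2) := by
    rw [Real.norm_of_nonneg (Real.sqrt_nonneg _)]
    gcongr
    exacts [isoProfile_nonneg _, isoProfile_le_one _, hC y]
  have herror : Tendsto (fun n : ℕ => Fintype.card (Fin (Module.finrank ℝ E)) *
      (2 * M * (√n)⁻¹)) atTop (𝓝 0) := by
    have hsqrt : Tendsto (fun n : ℕ => (√n)⁻¹) atTop (𝓝 0) :=
      (Real.tendsto_sqrt_atTop.comp tendsto_natCast_atTop_atTop).inv_tendsto_atTop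
    simpa only [mul_zero] using (hsqrt.const_mul (2 * M : ℝ)).const_mul _
  have hleft := (continuous_isoProfile.tendsto _).comp
    (tendsto_expect_signSum b hf.continuous fun y => by
      rw [Real.norm_of_nonneg (hf01 y).1]; exact (hf01 y).2)
  have hright := (tendsto_expect_signSum b hcont hbound).add herror
  rw [add_zero] at hright
  exact le_of_tendsto_of_tendsto' hleft hright (isoProfile_expect_signSum_le b hf hf01 hM)

/-! ### Smooth cutoff functions -/

section Mollification

variable {E : Type*} [NormedAddCommGroup E] [NormedSpace ℝ E] [FiniteDimensional ℝ E]

section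

variable [MeasurableSpace E] [BorelSpace E] {μ : Measure E} [μ.IsAddHaarMeasure]
  (w : ContDiffBump (0 : E)) {g : E → ℝ}

theorem integrable_normed_mul_comp_sub (hg : Continuous g) (x : E) :
    Integrable (fun t => w.normed μ t * g (x - t)) μ :=
  w.hasCompactSupport_normed.convolutionExists_left (ContinuousLinearMap.lsmul ℝ ℝ)
    w.continuous_normed hg.locallyIntegrable x

theorem lipschitzWith_normed_convolution {C : NNReal} (hg : LipschitzWith C g) :
    LipschitzWith C (w.normed μ ⋆[ContinuousLinearMap.lsmul ℝ ℝ, μ] g) := by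
  refine LipschitzWith.of_dist_le_mul fun x y => ?_
  simp only [convolution_lsmul, smul_eq_mul]
  rw [dist_eq_norm, ← integral_sub (integrable_normed_mul_comp_sub w hg.continuous x)
      (integrable_normed_mul_comp_sub w hg.continuous y)]
  calc ‖∫ t, (w.normed μ t * g (x - t) - w.normed μ t * g (y - t)) ∂μ‖
      ≤ ∫ t, w.normed μ t * (C * dist x y) ∂μ := by
        refine norm_integral_le_of_norm_le (w.integrable_normed.mul_const _)
          (Eventually.of_forall fun t => ?_)
        rw [← mul_sub, norm_mul, Real.norm_of_nonneg (w.nonneg_normed t), ← dist_eq_norm,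
          ← dist_sub_right x y t]
        gcongr
        exacts [w.nonneg_normed t, hg.dist_le_mul _ _]
    _ = C * dist x y := by rw [integral_mul_const, w.integral_normed, one_mul]

theorem normed_convolution_mem_Icc (hg : Continuous g) {a b : ℝ} (hgab : ∀ x, g x ∈ Set.Icc a b)
    (x : E) : (w.normed μ ⋆[ContinuousLinearMap.lsmul ℝ ℝ, μ] g) x ∈ Set.Icc a b := by
  have hint := integrable_normed_mul_comp_sub (μ := μ) w hg x
  have hmass (c : ℝ) : ∫ t, w.normed μ t * c ∂μ = c := by
    rw [integral_mul_const, w.integral_normed, one_mul]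
  simp only [convolution_lsmul, smul_eq_mul]
  constructor
  · rw [← hmass a]
    exact integral_mono (w.integrable_normed.mul_const a) hint fun t =>
      mul_le_mul_of_nonneg_left (hgab _).1 (w.nonneg_normed t)
  · rw [← hmass b]
    exact integral_mono hint (w.integrable_normed.mul_const b) fun t =>
      mul_le_mul_of_nonneg_left (hgab _).2 (w.nonneg_normed t)

end

theorem exists_contDiff_mollification {g : E → ℝ} {C : NNReal} (hg : LipschitzWith C g) {a b : ℝ}
    (hgab : ∀ x, g x ∈ Set.Icc a b) {κ : ℝ} (hκ : 0 < κ) :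
    ∃ f : E → ℝ, ContDiff ℝ 2 f ∧ LipschitzWith C f ∧ (∀ x, f x ∈ Set.Icc a b) ∧
      ∀ x, (∀ y ∈ Metric.ball x κ, g y = g x) → f x = g x := by
  borelize E
  let w : ContDiffBump (0 : E) := ⟨κ / 2, κ, half_pos hκ, half_lt_self hκ⟩
  let μ : Measure E := Measure.addHaar
  exact ⟨w.normed μ ⋆[ContinuousLinearMap.lsmul ℝ ℝ, μ] g,
    w.hasCompactSupport_normed.contDiff_convolution_left (n := 2) _ w.contDiff_normed
      hg.continuous.locallyIntegrable,
    lipschitzWith_normed_convolution w hg,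
    normed_convolution_mem_Icc w hg.continuous hgab,
    fun x hx => w.normed_convolution_eq_right hx⟩

theorem exists_contDiff_cutoff (A : Set E) {σ τ : ℝ} (hσ : 0 < σ) (hστ : σ < τ) :
    ∃ f : E → ℝ, ContDiff ℝ 2 f ∧ (∀ x, f x ∈ Set.Icc (0 : ℝ) 1) ∧ (∀ x ∈ A, f x = 1) ∧
      (∀ x ∉ Metric.cthickening τ A, f x = 0) ∧ ∀ x, ‖fderiv ℝ f x‖ ≤ σ⁻¹ := by
  let κ := (τ - σ) / 2
  have hκ : 0 < κ := half_pos (sub_pos.2 hστ)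
  let B := Metric.cthickening κ A
  let g (x : E) : ℝ := thickenedIndicator hσ B x
  have hgLip : LipschitzWith σ.toNNReal⁻¹ g :=
    LipschitzWith.of_dist_le_mul (lipschitzWith_thickenedIndicator hσ B).dist_le_mul
  have hg01 (x : E) : g x ∈ Set.Icc (0 : ℝ) 1 :=
    ⟨NNReal.coe_nonneg _, by exact_mod_cast thickenedIndicator_le_one hσ B x⟩
  have hg1 {x : E} (hx : x ∈ B) : g x = 1 := by simp only [g, thickenedIndicator_one hσ B hx,
    NNReal.coe_one]
  have hg0 {x : E} (hx : x ∉ Metric.thickening σ B) : g x = 0 := by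
    simp only [g, thickenedIndicator_zero hσ B hx, NNReal.coe_zero]
  obtain ⟨f, hf, hfLip, hf01, hfg⟩ := exists_contDiff_mollification hgLip hg01 hκ
  refine ⟨f, hf, hf01, fun x hx => ?_, fun x hx => ?_, fun x => ?_⟩
  · have hball {y : E} (hy : y ∈ Metric.ball x κ) : y ∈ B :=
      Metric.closedBall_subset_cthickening hx κ (Metric.ball_subset_closedBall hy)
    have hxB := hball (Metric.mem_ball_self hκ)
    rw [hfg x fun y hy => by rw [hg1 (hball hy), hg1 hxB], hg1 hxB]
  · have hball {y : E} (hy : y ∈ Metric.ball x κ) : y ∉ Metric.thickening σ B := fun hyB => by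
      have hxy : x ∈ Metric.thickening κ (Metric.thickening (σ + κ) A) :=
        Metric.mem_thickening_iff.2
          ⟨y, Metric.thickening_cthickening_subset σ hκ.le A hyB, Metric.mem_ball'.1 hy⟩
      refine hx (Metric.thickening_subset_cthickening τ A ?_)
      convert Metric.thickening_thickening_subset _ _ A hxy using 2
      ring
    have hxB := hball (Metric.mem_ball_self hκ)
    rw [hfg x fun y hy => by rw [hg0 (hball hy), hg0 hxB], hg0 hxB]
  · simpa only [NNReal.coe_inv, Real.coe_toNNReal _ hσ.le] using
      norm_fderiv_le_of_lipschitz ℝ hfLip (x₀ := x)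

end Mollification

/-! ### Growth of the Gaussian measure of a thickening -/

theorem integral_mem_Icc_of_cutoff {Ω : Type*} [MeasurableSpace Ω] {μ : Measure Ω}
    [IsFiniteMeasure μ] {A B : Set Ω} (hA : MeasurableSet A) (hB : MeasurableSet B) {f : Ω → ℝ}
    (hf : AEStronglyMeasurable f μ) (hf01 : ∀ x, f x ∈ Set.Icc (0 : ℝ) 1)
    (hfA : ∀ x ∈ A, f x = 1) (hfB : ∀ x ∉ B, f x = 0) :
    ∫ x, f x ∂μ ∈ Set.Icc (μ.real A) (μ.real B) := by
  have hint : Integrable f μ := .of_mem_Icc 0 1 hf.aemeasurable (Eventually.of_forall hf01)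
  rw [← integral_indicator_one hA, ← integral_indicator_one hB]
  constructor
  · refine integral_mono ((integrable_const 1).indicator hA) hint ?_
    exact Set.indicator_le' (fun x hx => (hfA x hx).ge) fun x _ => (hf01 x).1
  · refine integral_mono hint ((integrable_const 1).indicator hB) ?_
    exact Set.le_indicator (fun x _ => (hf01 x).2) fun x hx => (hfB x hx).le

theorem sqrt_isoProfile_sq_add_norm_fderiv_sq_le_indicator {E : Type*} [NormedAddCommGroup E]
    [NormedSpace ℝ E] {A B : Set E} {f : E → ℝ} (hf01 : ∀ x, f x ∈ Set.Icc (0 : ℝ) 1)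
    (hfA : ∀ x ∈ A, f x = 1) (hfB : ∀ x ∉ B, f x = 0) {C : ℝ} (hC : ∀ x, ‖fderiv ℝ f x‖ ≤ C)
    (x : E) :
    √(isoProfile (f x) ^ 2 + ‖fderiv ℝ f x‖ ^ 2) ≤ (B \ A).indicator (fun _ => 1 + C) x := by
  by_cases hxA : x ∈ A
  · have hmax : IsLocalMax f x := Eventually.of_forall fun y => (hf01 y).2.trans_eq (hfA x hxA).symm
    simp [hxA, hfA x hxA, hmax.fderiv_eq_zero, isoProfile_one]
  by_cases hxB : x ∈ B
  · rw [Set.indicator_of_mem (Set.mem_sdiff_of_mem hxB hxA)]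
    have hC0 : 0 ≤ C := (norm_nonneg _).trans (hC x)
    calc √(isoProfile (f x) ^ 2 + ‖fderiv ℝ f x‖ ^ 2) ≤ √(1 ^ 2 + C ^ 2) := by
          gcongr
          exacts [isoProfile_nonneg _, isoProfile_le_one _, hC x]
      _ ≤ 1 + C := Real.sqrt_le_iff.2 ⟨by positivity, by nlinarith⟩
  · have hmin : IsLocalMin f x := Eventually.of_forall fun y => (hfB x hxB).trans_le (hf01 y).1
    simp [hxB, hfB x hxB, hmin.fderiv_eq_zero, isoProfile_zero]

section Growth

variable {E : Type*} [NormedAddCommGroup E] [InnerProductSpace ℝ E] [FiniteDimensional ℝ E]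
  [MeasurableSpace E] [BorelSpace E]

theorem min_isoProfile_le_of_cutoff {A B : Set E} (hA : MeasurableSet A) (hB : MeasurableSet B)
    {f : E → ℝ} (hf : Differentiable ℝ f) (hf01 : ∀ x, f x ∈ Set.Icc (0 : ℝ) 1)
    (hfA : ∀ x ∈ A, f x = 1) (hfB : ∀ x ∉ B, f x = 0) {M : NNReal}
    (hM : LipschitzWith M (fderiv ℝ f)) {C : ℝ} (hC : ∀ x, ‖fderiv ℝ f x‖ ≤ C) :
    min (isoProfile ((stdGaussian E).real A)) (isoProfile ((stdGaussian E).real B)) ≤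
      (1 + C) * ((stdGaussian E).real B - (stdGaussian E).real A) := by
  have hAB : A ⊆ B := fun x hxA => by_contra fun hxB => by simpa [hfA x hxA] using hfB x hxB
  have hprob (S : Set E) : (stdGaussian E).real S ∈ Set.Icc (0 : ℝ) 1 :=
    ⟨measureReal_nonneg, measureReal_le_one⟩
  calc min (isoProfile ((stdGaussian E).real A)) (isoProfile ((stdGaussian E).real B))
      ≤ isoProfile (∫ x, f x ∂(stdGaussian E)) :=
        concaveOn_isoProfile.min_le_of_mem_Icc (hprob A) (hprob B)
          (integral_mem_Icc_of_cutoff hA hB hf.continuous.aestronglyMeasurable hf01 hfA hfB)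
    _ ≤ ∫ x, √(isoProfile (f x) ^ 2 + ‖fderiv ℝ f x‖ ^ 2) ∂(stdGaussian E) :=
        bobkov_stdGaussian hf hf01 hM hC
    _ ≤ ∫ x, (B \ A).indicator (fun _ => 1 + C) x ∂(stdGaussian E) :=
        integral_mono_of_nonneg (Eventually.of_forall fun _ => Real.sqrt_nonneg _)
          ((integrable_const _).indicator (hB.diff hA)) (Eventually.of_forall
            (sqrt_isoProfile_sq_add_norm_fderiv_sq_le_indicator hf01 hfA hfB hC))
    _ = (1 + C) * ((stdGaussian E).real B - (stdGaussian E).real A) := by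
        rw [integral_indicator_const _ (hB.diff hA), measureReal_sdiff hAB hA, smul_eq_mul,
          mul_comm]

theorem min_isoProfile_le_cthickening {A : Set E} (hA : IsCompact A) {τ : ℝ} (hτ : 0 < τ) :
    min (isoProfile ((stdGaussian E).real A))
        (isoProfile ((stdGaussian E).real (Metric.cthickening τ A))) ≤
      (2 + τ⁻¹) * ((stdGaussian E).real (Metric.cthickening τ A) - (stdGaussian E).real A) := by
  have hσ : τ / (1 + τ) < τ := div_lt_self hτ (by linarith)
  obtain ⟨f, hf, hf01, hfA, hfB, hC⟩ := exists_contDiff_cutoff A (by positivity) hσ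
  have hsupp : HasCompactSupport f := .intro hA.cthickening hfB
  obtain ⟨M, hM⟩ := ContDiff.lipschitzWith_of_hasCompactSupport (hsupp.fderiv ℝ)
    (hf.fderiv_right (m := 1) (by norm_num)) one_ne_zero
  convert min_isoProfile_le_of_cutoff hA.measurableSet hA.cthickening.measurableSet
    (hf.differentiable two_ne_zero) hf01 hfA hfB hM hC using 2
  field_simp
  ring

end Growth

theorem stdGaussianPDFReal_le_mul_exp {R x y : ℝ} (hx : |x| ≤ R) (hy : |y| ≤ R) :
    φ x ≤ φ y * Real.exp (R * |x - y|) := by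
  rw [gaussianPDFReal_eq_mul_exp 0 1 x y]
  gcongr
  · exact gaussianPDFReal_nonneg 0 1 y
  have hsum : |y + x| ≤ 2 * R := (abs_add_le y x).trans (by linarith)
  calc ((y - 0) ^ 2 - (x - 0) ^ 2) / (2 * (1 : NNReal)) = (y + x) * (y - x) / 2 := by
        push_cast; ring
    _ ≤ |y + x| * |x - y| / 2 := by
        rw [abs_sub_comm x, ← abs_mul]; gcongr; exact le_abs_self _
    _ ≤ R * |x - y| := by nlinarith [abs_nonneg (x - y)]

theorem Phi_sub_Phi_le {y y' C : ℝ} (hyy' : y ≤ y') (hC : ∀ x ∈ Set.Icc y y', φ x ≤ C) :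
    Phi y' - Phi y ≤ C * (y' - y) := by
  have h := Convex.norm_image_sub_le_of_norm_hasDerivWithin_le
    (fun x _ => (hasDerivAt_Phi x).hasDerivWithinAt)
    (fun x hx => (Real.norm_of_nonneg (gaussianPDFReal_nonneg 0 1 x)).trans_le (hC x hx))
    (convex_Icc y y') (Set.left_mem_Icc.2 hyy') (Set.right_mem_Icc.2 hyy')
  rw [Real.norm_of_nonneg (sub_nonneg.2 hyy')] at h
  exact (le_abs_self _).trans h

theorem add_mul_le_of_min_stdGaussianPDFReal_le {y y' R τ : ℝ} (hyy' : y ≤ y') (hy : |y| ≤ R)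
    (hy' : |y'| ≤ R) (hτ : 0 < τ)
    (h : min (φ y) (φ y') ≤ (2 + τ⁻¹) * (Phi (y' : ℝ) - Phi (y : ℝ))) :
    y + τ * (Real.exp (-(R * τ)) / (1 + 2 * τ)) ≤ y' := by
  have hR : 0 ≤ R := (abs_nonneg y).trans hy
  have hfactor : Real.exp (-(R * τ)) / (1 + 2 * τ) ≤ 1 :=
    div_le_one_of_le₀ ((Real.exp_le_one_iff.2 (by nlinarith)).trans (by linarith)) (by positivity)
  rcases le_or_gt (y + τ) y' with hfar | hnear
  · nlinarith
  set m := min (φ y) (φ y')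
  have hm : 0 < m := lt_min (stdGaussianPDFReal_pos y) (stdGaussianPDFReal_pos y')
  have hpdf : ∀ x ∈ Set.Icc y y', φ x ≤ m * Real.exp (R * τ) := fun x hx => by
    have hxR : |x| ≤ R := (abs_le_max_abs_abs hx.1 hx.2).trans (max_le hy hy')
    have hcompare {z : ℝ} (hz : |z| ≤ R) (hxz : |x - z| ≤ τ) : φ x ≤ φ z * Real.exp (R * τ) := by
      refine (stdGaussianPDFReal_le_mul_exp hxR hz).trans ?_
      gcongr
      exact gaussianPDFReal_nonneg 0 1 z
    rw [min_mul_of_nonneg _ _ (Real.exp_nonneg _)]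
    refine le_min (hcompare hy ?_) (hcompare hy' ?_) <;> rw [abs_le] <;>
      constructor <;> linarith [hx.1, hx.2]
  have hlower : 1 ≤ (2 + τ⁻¹) * Real.exp (R * τ) * (y' - y) := by
    refine le_of_mul_le_mul_left ?_ hm
    calc m * 1 ≤ (2 + τ⁻¹) * (Phi y' - Phi y) := (mul_one m).trans_le h
      _ ≤ (2 + τ⁻¹) * (m * Real.exp (R * τ) * (y' - y)) := by
        gcongr
        exact Phi_sub_Phi_le hyy' hpdf
      _ = m * ((2 + τ⁻¹) * Real.exp (R * τ) * (y' - y)) := by ring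
  have hcancel : τ * (Real.exp (-(R * τ)) / (1 + 2 * τ)) * ((2 + τ⁻¹) * Real.exp (R * τ)) = 1 := by
    rw [Real.exp_neg]
    field_simp
    ring
  have := mul_le_mul_of_nonneg_left hlower
    (by positivity : 0 ≤ τ * (Real.exp (-(R * τ)) / (1 + 2 * τ)))
  rw [mul_one, ← mul_assoc, hcancel, one_mul] at this
  linarith

theorem add_le_of_forall_add_mul_le {Q c : ℝ → ℝ} {s : ℝ} (hs : 0 < s)
    (hstep : ∀ t τ, 0 ≤ t → 0 < τ → t + τ ≤ s → Q t + τ * c τ ≤ Q (t + τ))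
    (hc : Tendsto c (𝓝[>] 0) (𝓝 1)) : Q 0 + s ≤ Q s := by
  have hiterate (n : ℕ) (hn : 0 < n) : Q 0 + s * c (s / n) ≤ Q s := by
    have hn0 : (0 : ℝ) < n := by exact_mod_cast hn
    have hk (k : ℕ) (hkn : k ≤ n) : Q 0 + k * (s / n * c (s / n)) ≤ Q (k * (s / n)) := by
      induction k with
      | zero => simp
      | succ k ih =>
        have hks : ((k + 1 : ℕ) : ℝ) * (s / n) ≤ s := by
          calc ((k + 1 : ℕ) : ℝ) * (s / n) ≤ n * (s / n) := by gcongr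
            _ = s := mul_div_cancel₀ s hn0.ne'
        push_cast at hks ⊢
        have := hstep (k * (s / n)) (s / n) (by positivity) (by positivity) (by linarith)
        rw [add_one_mul, add_one_mul]
        linarith [ih (by lia)]
    simpa only [← mul_assoc, mul_div_cancel₀ s hn0.ne'] using hk n le_rfl
  have hmesh : Tendsto (fun n : ℕ => s / n) atTop (𝓝[>] 0) :=
    tendsto_nhdsWithin_iff.2 ⟨tendsto_const_div_atTop_nhds_zero_nat s,
      (eventually_gt_atTop 0).mono fun n hn => div_pos hs (by exact_mod_cast hn)⟩
  refine le_of_tendsto ?_ ((eventually_gt_atTop 0).mono hiterate)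
  simpa using ((hc.comp hmesh).const_mul s).const_add (Q 0)

section Isoperimetry

variable {E : Type*} [NormedAddCommGroup E] [InnerProductSpace ℝ E] [FiniteDimensional ℝ E]
  [MeasurableSpace E] [BorelSpace E]

theorem quantile_measureReal_add_mul_le {A : Set E} (hA : IsCompact A) {R τ : ℝ} (hτ : 0 < τ)
    (hpos : 0 < (stdGaussian E).real A)
    (hlt : (stdGaussian E).real (Metric.cthickening τ A) < 1)
    (hR : |quantile ((stdGaussian E).real A)| ≤ R)
    (hR' : |quantile ((stdGaussian E).real (Metric.cthickening τ A))| ≤ R) :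
    quantile ((stdGaussian E).real A) + τ * (Real.exp (-(R * τ)) / (1 + 2 * τ)) ≤
      quantile ((stdGaussian E).real (Metric.cthickening τ A)) := by
  have hle : (stdGaussian E).real A ≤ (stdGaussian E).real (Metric.cthickening τ A) :=
    measureReal_mono (Metric.self_subset_cthickening A)
  have ha : (stdGaussian E).real A ∈ Set.Ioo (0 : ℝ) 1 := ⟨hpos, hle.trans_lt hlt⟩
  have hb : (stdGaussian E).real (Metric.cthickening τ A) ∈ Set.Ioo (0 : ℝ) 1 :=
    ⟨hpos.trans_le hle, hlt⟩
  have h := min_isoProfile_le_cthickening hA hτ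
  rw [isoProfile_of_mem ha, isoProfile_of_mem hb] at h
  refine add_mul_le_of_min_stdGaussianPDFReal_le
    (strictMonoOn_quantile.monotoneOn ha hb hle) hR hR' hτ ?_
  rwa [Phi_quantile ha, Phi_quantile hb]

theorem quantile_add_le_cthickening {A : Set E} (hA : IsCompact A) {s : ℝ} (hs : 0 < s)
    (hpos : 0 < (stdGaussian E).real A)
    (hlt : (stdGaussian E).real (Metric.cthickening s A) < 1) :
    quantile ((stdGaussian E).real A) + s ≤
      quantile ((stdGaussian E).real (Metric.cthickening s A)) := by
  let G (t : ℝ) := (stdGaussian E).real (Metric.cthickening t A)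
  have hG0 : G 0 = (stdGaussian E).real A := by
    simp only [G, Metric.cthickening_zero, hA.isClosed.closure_eq]
  have hGmono : Monotone G := fun a b hab => measureReal_mono (Metric.cthickening_mono hab A)
  have hGmem : ∀ t ∈ Set.Icc 0 s, G t ∈ Set.Ioo (0 : ℝ) 1 := fun t ht =>
    ⟨hpos.trans_le (hG0 ▸ hGmono ht.1), (hGmono ht.2).trans_lt hlt⟩
  have hQmono : MonotoneOn (fun t => quantile (G t)) (Set.Icc 0 s) := fun t ht t' ht' h =>
    strictMonoOn_quantile.monotoneOn (hGmem t ht) (hGmem t' ht') (hGmono h)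
  let R := max |quantile (G 0)| |quantile (G s)|
  have hQR : ∀ t ∈ Set.Icc 0 s, |quantile (G t)| ≤ R := fun t ht =>
    abs_le_max_abs_abs (hQmono (Set.left_mem_Icc.2 hs.le) ht ht.1)
      (hQmono ht (Set.right_mem_Icc.2 hs.le) ht.2)
  have hstep (t τ : ℝ) (ht : 0 ≤ t) (hτ : 0 < τ) (hts : t + τ ≤ s) :
      quantile (G t) + τ * (Real.exp (-(R * τ)) / (1 + 2 * τ)) ≤ quantile (G (t + τ)) := by
    have ht' : t ∈ Set.Icc 0 s := ⟨ht, by linarith⟩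
    have htτ : t + τ ∈ Set.Icc 0 s := ⟨by linarith, hts⟩
    have hthick : Metric.cthickening τ (Metric.cthickening t A) = Metric.cthickening (t + τ) A := by
      rw [cthickening_cthickening hτ.le ht, add_comm]
    have h := quantile_measureReal_add_mul_le (hA.cthickening (r := t)) (R := R) hτ (hGmem t ht').1
    rw [hthick] at h
    exact h (hGmem _ htτ).2 (hQR t ht') (hQR _ htτ)
  have hrate : Tendsto (fun τ => Real.exp (-(R * τ)) / (1 + 2 * τ)) (𝓝[>] 0) (𝓝 1) := by
    have : ContinuousAt (fun τ => Real.exp (-(R * τ)) / (1 + 2 * τ)) 0 := by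
      fun_prop (disch := norm_num)
    simpa using this.tendsto.mono_left nhdsWithin_le_nhds
  simpa only [hG0] using add_le_of_forall_add_mul_le hs hstep hrate

end Isoperimetry

/-! ### The Gaussian isoperimetric inequality -/

theorem monotone_Phi_PhiInv_add (s : EReal) : Monotone fun a => Phi (PhiInv a + s) := fun _ _ h =>
  Phi_strictMono.monotone (add_le_add_left (monotone_PhiInv h) s)

theorem continuous_Phi_PhiInv_add (s : ℝ) : Continuous fun a => Phi (PhiInv a + s) :=
  continuous_iff_continuousAt.2 fun _ => continuous_Phi.continuousAt.comp <|
    (EReal.continuousAt_add (.inr (EReal.coe_ne_bot s)) (.inr (EReal.coe_ne_top s))).comp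
      (continuous_PhiInv.continuousAt.prodMk continuousAt_const)

section MeasurableSets

variable {E : Type*} [NormedAddCommGroup E] [InnerProductSpace ℝ E] [FiniteDimensional ℝ E]
  [MeasurableSpace E] [BorelSpace E]

theorem Phi_PhiInv_add_le_cthickening {A : Set E} (hA : IsCompact A) {s : ℝ} (hs : 0 < s) :
    Phi (PhiInv ((stdGaussian E).real A) + s) ≤
      (stdGaussian E).real (Metric.cthickening s A) := by
  rcases (measureReal_le_one (μ := stdGaussian E) (s := Metric.cthickening s A)).eq_or_lt
    with hone | hlt
  · exact hone ▸ (Phi_mem_Icc _).2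
  rcases (measureReal_nonneg (μ := stdGaussian E) (s := A)).eq_or_lt with hzero | hpos
  · rw [← hzero, ← Phi_bot, PhiInv_Phi, EReal.bot_add, Phi_bot]
    exact measureReal_nonneg
  have hle : (stdGaussian E).real A ≤ (stdGaussian E).real (Metric.cthickening s A) :=
    measureReal_mono (Metric.self_subset_cthickening A)
  obtain ⟨y, hy⟩ := exists_eq_Phi_coe ⟨hpos, hle.trans_lt hlt⟩
  obtain ⟨y', hy'⟩ := exists_eq_Phi_coe ⟨hpos.trans_le hle, hlt⟩
  have hquantile := quantile_add_le_cthickening hA hs hpos hlt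
  rw [hy, hy', quantile_Phi, quantile_Phi] at hquantile
  rw [hy, hy', PhiInv_Phi]
  exact Phi_strictMono.monotone (by exact_mod_cast hquantile)

theorem exists_isCompact_Phi_PhiInv_lt {S : Set E} (hS : MeasurableSet S) (s : ℝ) {c : ℝ}
    (hc : c < Phi (PhiInv ((stdGaussian E).real S) + s)) :
    ∃ A ⊆ S, IsCompact A ∧ c < Phi (PhiInv ((stdGaussian E).real A) + s) := by
  obtain ⟨a, haS, hca⟩ := (((continuous_Phi_PhiInv_add s).tendsto
    ((stdGaussian E).real S)).eventually (lt_mem_nhds hc)).exists_lt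
  obtain ⟨A, hAS, hA, hdiff⟩ := hS.exists_isCompact_sdiff_lt (measure_ne_top (stdGaussian E) S)
    (ENNReal.ofReal_pos.2 (sub_pos.2 haS)).ne'
  refine ⟨A, hAS, hA, hca.trans_le (monotone_Phi_PhiInv_add s ?_)⟩
  have := ENNReal.toReal_lt_of_lt_ofReal hdiff
  rw [← Measure.real, measureReal_sdiff hAS hA.measurableSet] at this
  linarith

theorem Phi_PhiInv_add_sub_le_inter {S : Set E} (hS : MeasurableSet S) {s : ℝ} (hs : 0 < s)
    {G : Set E} {δ : ℝ} (hG : 1 - δ ≤ (stdGaussian E).real G) :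
    Phi (PhiInv ((stdGaussian E).real S) + s) - δ ≤
      (stdGaussian E).real ({z | ∃ z' ∈ S, dist z' z ≤ s} ∩ G) := by
  refine le_of_forall_lt fun c hc => ?_
  obtain ⟨A, hAS, hA, hcA⟩ := exists_isCompact_Phi_PhiInv_lt hS s (lt_sub_iff_add_lt.1 hc)
  have hthick : MeasurableSet (Metric.cthickening s A) := hA.cthickening.measurableSet
  have hsplit := measureReal_inter_add_sdiff (μ := stdGaussian E) (s := G) hthick
  have hcompl : (stdGaussian E).real (G \ Metric.cthickening s A) ≤
      1 - (stdGaussian E).real (Metric.cthickening s A) := by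
    rw [← probReal_compl_eq_one_sub hthick]
    exact measureReal_mono fun z hz => hz.2
  have hinter : (stdGaussian E).real (G ∩ Metric.cthickening s A) ≤
      (stdGaussian E).real ({z | ∃ z' ∈ S, dist z' z ≤ s} ∩ G) := by
    rw [hA.cthickening_eq_biUnion_closedBall hs.le]
    refine measureReal_mono fun z ⟨hzG, hz⟩ => ⟨?_, hzG⟩
    obtain ⟨z', hz', hzz'⟩ := Set.mem_iUnion₂.1 hz
    exact ⟨z', hAS hz', (dist_comm z' z).trans_le hzz'⟩
  linarith [Phi_PhiInv_add_le_cthickening hA hs]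

end MeasurableSets

/-! ### Adversarial risk of conditional generative models -/

theorem Phi_PhiInv_add_sub_le_of_locLipschitz {d : ℕ} {X : Type*} [MetricSpace X]
    [MeasurableSpace X] {g : EuclideanSpace ℝ (Fin d) → X} (hg : Measurable g) {B : Set X}
    (hB : MeasurableSet B) {ε r L δ : ℝ} (hε : 0 < ε) (hr : 0 < r)
    (hL : LocLipschitzWithProb g r L δ) (hrL : ε ≤ r * L) :
    Phi (PhiInv (((nu d).map g).real B) + ((ε / L : ℝ) : EReal)) - δ ≤
      (nu d).real {z | ∃ z', g z' ∈ Metric.closedBall (g z) ε ∧ g z' ∈ B} := by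
  have hL0 : 0 < L := pos_of_mul_pos_right (hε.trans_le hrL) hr.le
  rw [map_measureReal_apply hg hB]
  refine (Phi_PhiInv_add_sub_le_inter (hg hB) (div_pos hε hL0) hL).trans (measureReal_mono ?_)
  rintro z ⟨⟨z', hz', hdist⟩, hz⟩
  refine ⟨z', ?_, hz'⟩
  calc dist (g z') (g z) ≤ L * ‖z' - z‖ := hz z' (hdist.trans ((div_le_iff₀ hL0).2 hrL))
    _ ≤ L * (ε / L) := by rw [← dist_eq_norm]; gcongr
    _ = ε := mul_div_cancel₀ ε hL0.ne'

namespace CondGenModel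

variable {d K : ℕ} {X : Type*} [MeasurableSpace X]

theorem isProbabilityMeasure_classMeasure (M : CondGenModel d K X) (i : Fin K) :
    IsProbabilityMeasure (M.classMeasure i) :=
  Measure.isProbabilityMeasure_map (M.measurable_g i).aemeasurable

theorem isFiniteMeasure_jointMeasure (M : CondGenModel d K X) :
    IsFiniteMeasure M.jointMeasure := by
  have := M.isProbabilityMeasure_classMeasure
  have (i : Fin K) : IsFiniteMeasure ((M.classMeasure i).map fun x => (x, i)) :=
    Measure.isFiniteMeasure_map _ _
  exact ⟨by simp [jointMeasure, ENNReal.mul_lt_top]⟩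

theorem map_fst_jointMeasure (M : CondGenModel d K X) :
    M.jointMeasure.map Prod.fst = ∑ i, ENNReal.ofReal (M.p i) • M.classMeasure i := by
  rw [jointMeasure, Measure.map_finset_sum' measurable_fst.aemeasurable]
  refine Finset.sum_congr rfl fun i _ => ?_
  rw [Measure.map_smul, Measure.map_map measurable_fst measurable_prodMk_right]
  exact congrArg _ Measure.map_id

theorem sum_mul_le_jointMeasure_real (M : CondGenModel d K X) (S : Set (X × Fin K)) :
    ∑ i, M.p i * (nu d).real {z | (M.g i z, i) ∈ S} ≤ M.jointMeasure.real S := by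
  have := M.isFiniteMeasure_jointMeasure
  have hclass (i : Fin K) : nu d {z | (M.g i z, i) ∈ S} ≤
      (M.classMeasure i).map (fun x => (x, i)) S := by
    rw [classMeasure, Measure.map_map measurable_prodMk_right (M.measurable_g i)]
    exact Measure.le_map_apply (measurable_prodMk_right.comp (M.measurable_g i)).aemeasurable S
  have hsum : ∑ i, ENNReal.ofReal (M.p i) * nu d {z | (M.g i z, i) ∈ S} ≤ M.jointMeasure S := by
    simp only [jointMeasure, Measure.coe_finsetSum, Finset.sum_apply, Measure.smul_apply,
      smul_eq_mul]
    gcongr with i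
    exact hclass i
  have hreal := ENNReal.toReal_mono (measure_ne_top _ S) hsum
  rw [ENNReal.toReal_sum fun i _ => by finiteness] at hreal
  simpa only [ENNReal.toReal_mul, ENNReal.toReal_ofReal (M.p_mem _).1, measureReal_def] using hreal

theorem Generates.sum_p {M : CondGenModel d K X} {μ : Measure X} [IsProbabilityMeasure μ]
    (hM : M.Generates μ) : ∑ i, M.p i = 1 := by
  have := M.isProbabilityMeasure_classMeasure
  have hmass : μ Set.univ = ENNReal.ofReal (∑ i, M.p i) := by
    rw [hM, ENNReal.ofReal_sum_of_nonneg fun i _ => (M.p_mem i).1]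
    simp
  exact ENNReal.ofReal_eq_one.1 (hmass.symm.trans measure_univ)

theorem Generates.inAdvRisk_le_advRisk {X : Type*} [MetricSpace X] [MeasurableSpace X]
    {M : CondGenModel d K X} {μ : Measure X} (hM : M.Generates μ) {Y : Type*} (fstar f : X → Y)
    (ε : ℝ) : M.InAdvRisk fstar f ε ≤ AdvRisk μ fstar f ε := by
  have := M.isFiniteMeasure_jointMeasure
  rw [hM, ← M.map_fst_jointMeasure]
  refine (measureReal_mono ?_).trans
    (ENNReal.toReal_mono (measure_ne_top _ _) (Measure.le_map_apply measurable_fst.aemeasurable _))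
  exact fun q ⟨z', hball, herr⟩ => ⟨M.g q.2 z', hball, herr⟩

end CondGenModel

theorem theorem1_general {d K : ℕ} {X Y : Type*} [MetricSpace X] [MeasurableSpace X]
    {μ : Measure X} {M : CondGenModel d K X} (hM : M.Generates μ) {ε : ℝ} (hε : 0 < ε)
    {r L δ : Fin K → ℝ} (hr : ∀ i, 0 < r i)
    (hLip : ∀ i, LocLipschitzWithProb (M.g i) (r i) (L i) (δ i)) (hrL : ∀ i, ε ≤ r i * L i)
    {fstar f : X → Y} (hf : MeasurableSet {x | f x ≠ fstar x}) :
    M.InAdvRisk fstar f ε ≤ AdvRisk μ fstar f ε ∧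
      ∑ i, M.p i * (Phi (PhiInv (Risk (M.classMeasure i) fstar f) + ((ε / L i : ℝ) : EReal)) - δ i)
        ≤ M.InAdvRisk fstar f ε := by
  refine ⟨hM.inAdvRisk_le_advRisk fstar f ε, ?_⟩
  refine (Finset.sum_le_sum fun i _ => ?_).trans (M.sum_mul_le_jointMeasure_real _)
  exact mul_le_mul_of_nonneg_left
    (Phi_PhiInv_add_sub_le_of_locLipschitz (M.measurable_g i) hf hε (hr i) (hLip i) (hrL i))
    (M.p_mem i).1

theorem theorem1 {d K : ℕ} {X : Type*} [MetricSpace X] [MeasurableSpace X]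
    (μ : Measure X) [IsProbabilityMeasure μ]
    (fstar : X → Fin K) (hfstar : Measurable fstar)
    (M : CondGenModel d K X) (hM : M.Generates μ)
    (ε : ℝ) (hε : 0 < ε) (r : ℝ) (hr : 0 < r) (δ : ℝ) (hδ : δ ∈ Set.Ioc (0 : ℝ) 1)
    (L : Fin K → ℝ → ℝ)
    (hLip : ∀ i, LocLipschitzWithProb (M.g i) r (L i r) δ)
    (hrL : ∀ i, ε ≤ r * L i r)
    (f : X → Fin K) (hf : Measurable f) :
    M.InAdvRisk fstar f ε ≤ AdvRisk μ fstar f ε ∧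
      ∑ i, M.p i * Phi (PhiInv (Risk (M.classMeasure i) fstar f) + ((ε / L i r : ℝ) : EReal)) - δ
        ≤ M.InAdvRisk fstar f ε := by
  simpa only [mul_sub, Finset.sum_sub_distrib, ← Finset.sum_mul, hM.sum_p, one_mul] using
    theorem1_general hM hε (fun _ => hr) hLip hrL (measurableSet_eq_fun hf hfstar).compl
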